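/- **Setting.** Fix a universal prefix machine and let $K(x\mid y)$ be the conditional prefix Kolmogorov complexity with respect to it. Fix a training software, i.e. programs which, from a string $a$ (the architecture of the model), determine a finite set $\mathbb F$ of (rational) machine numbers and a step size $\alpha$, and which compute, from $a$ and a parameter vector $W$, whether the model classifies an element $x$ correctly, and, for a batch $B$ of elements listed in the order of their ids, the step $W-\alpha\widetilde{\nabla f_B}(W)$; here $\widetilde{\nabla f_B}$ is the computed (approximate) gradient of the average loss on $B$. Let $X$ be a dataset of $n$ elements with distinct ids, $b\ge 1$ a batch size dividing $n$, $t$ a number of epochs, $W_{1,1}$ an initial model with $d$ parameters, $\epsilon\in(0,1)$, $\beta'>0$ and $\beta=\beta'\epsilon$. In epoch $i=1,2,\dots,t$, SGD draws a uniformly random permutation $r_i$ of $X$ (independent over epochs), cuts it into consecutive batches $B_{i,1},\dots,B_{i,n/b}$ of size $b$, and puts $W_{i,j+1}=W_{i,j}-\alpha\widetilde{\nabla f_{B_{i,j}}}(W_{i,j})$ for $j=1,\dots,n/b$, and $W_{i+1,1}=W_{i,n/b+1}$. It terminates as soon as $acc(W_{i,j},X)\ge 1-\epsilon$, where $acc(W,A)$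 is the fraction of the elements of $A$ that $W$ classifies correctly. In conditions of $K$, a model $W_{i,j}$ stands for its parameters together with its architecture and the indices $i,j$. Assume that $b\ge 8\beta^{-2}\ln^2(tn^3)$, that $n\ge 20\,b/\beta$ ($n$ is sufficiently large), and that, for some $L$, $0<\alpha<1/L$ (that is, $\alpha>0$ and $\alpha L<1$) and $\|\widetilde{\nabla f_A}(W)-\widetilde{\nabla f_A}(W')\|\le L\|W-W'\|$ for all nonempty $A\subseteq X$ and all $W,W'\in\mathbb F^d$. **Statement.** There is a constant $C$, depending only on the universal machine and the training software, such that in this setting the following holds with probability at least $1-1/n^2$: if throughout the $t$ epochs 1. (precision) $W_{i,j}\in\mathbb F^d$ for all $i\le t$, $j\le n/b$; 2. (no termination) $acc(W_{i,j},X)<1-\epsilon$ for all $i\le t$, $j\le n/b$; 3. (local progress) $\frac bn\sum_{j=2}^{n/b+1}\bigl(acc(W_{i,j},B_{i,j-1})-acc(W_{i,j-1},B_{i,j-1})\bigr)>\beta$ for all $i\le t$; 4. (simple functions) $K(acc(W_{i,j},\bullet)\mid X)\le n\beta^3/512$ for all $i\le t$, $j\le n/b$, where $acc(W_{i,j},\bullet):X\to\{0,1\}$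 is the indicator of correct classification; then for every epoch $i\le t$ $$K(r_i\mid X,W_{i+1,1})\le n\Bigl(\log_2\frac ne-\frac{\beta^3}{512}\Bigr)+C\log_2 n .$$ -/

import Mathlib

namespace SGD

/-! ## Prefix Kolmogorov complexity -/

/-- Finite binary strings. -/
abbrev Bits := List Bool

/-- A prefix machine: a partial recursive map `(program, auxiliary input) ↦ output` such that, for
every auxiliary input, no halting program is a proper prefix of another halting program. -/
def IsPrefixMachine (M : Bits → ℕ →. ℕ) : Prop :=
  Partrec₂ M ∧
    ∀ (y : ℕ) (p q : Bits), p <+: q → (M p y).Dom → (M q y).Dom → p = q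

/-- A universal (additively optimal) prefix machine: it describes every object at most a constant
number of bits less concisely than any other prefix machine. -/
def IsUniversalPrefixMachine (U : Bits → ℕ →. ℕ) : Prop :=
  IsPrefixMachine U ∧
    ∀ M : Bits → ℕ →. ℕ, IsPrefixMachine M → ∃ c : ℕ, ∀ (p : Bits) (y x : ℕ),
      x ∈ M p y → ∃ q : Bits, x ∈ U q y ∧ q.length ≤ p.length + c

/-- `K(x | y)` with reference machine `U`: the length of a shortest program from which `U`, with
auxiliary input `y`, outputs `x`. Objects are presented to machines by their standard codes. -/
noncomputable def condK {α β : Type} [Primcodable α] [Primcodable β]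
    (U : Bits → ℕ →. ℕ) (x : α) (y : β) : ℕ :=
  sInf {m : ℕ | ∃ p : Bits, p.length = m ∧ Encodable.encode x ∈ U p (Encodable.encode y)}

/-! Universal prefix machines exist. -/

section Existence

open Nat.Partrec (Code)

/-- One test of the search: the candidate `w` is a pair (program `q`, number of steps `k`); it is
accepted if `q` is comparable with `p` and the code `c` halts on `q` within `k` steps. -/
def probe (a : Code × Bits × ℕ) (w : ℕ) : Option (Bool × ℕ) :=
  (Encodable.decode (α := Bits × ℕ) w).bind fun v =>
    bif decide (v.1.take a.2.1.length = a.2.1.take v.1.length) then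
      (Code.evaln v.2 a.1 (Encodable.encode (v.1, a.2.2))).map fun o => (decide (v.1 = a.2.1), o)
    else none

def selfDelim (a : Code × Bits × ℕ) : Part ℕ :=
  (Nat.rfindOpt (probe a)).bind fun r => ((bif r.1 then some r.2 else none : Option ℕ) : Part ℕ)

def refArg (p : Bits) (y : ℕ) : Option (Code × Bits × ℕ) :=
  bif decide (p.idxOf false < p.length) then
    some (Denumerable.ofNat Code (p.idxOf false), p.drop (p.idxOf false + 1), y)
  else none

def refMachine (p : Bits) (y : ℕ) : Part ℕ :=
  ((refArg p y : Option _) : Part (Code × Bits × ℕ)).bind selfDelim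

theorem probe_primrec : Primrec₂ probe := by
  unfold probe
  have hdec : Primrec fun x : (Code × Bits × ℕ) × ℕ => Encodable.decode (α := Bits × ℕ) x.2 :=
    Primrec.decode.comp Primrec.snd
  refine Primrec.option_bind hdec ?_
  -- variables: x.1 = (a, w), x.2 = v
  have ha : Primrec fun x : ((Code × Bits × ℕ) × ℕ) × (Bits × ℕ) => x.1.1 :=
    Primrec.fst.comp Primrec.fst
  have hc : Primrec fun x : ((Code × Bits × ℕ) × ℕ) × (Bits × ℕ) => x.1.1.1 := Primrec.fst.comp ha
  have hp : Primrec fun x : ((Code × Bits × ℕ) × ℕ) × (Bits × ℕ) => x.1.1.2.1 :=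
    Primrec.fst.comp (Primrec.snd.comp ha)
  have hy : Primrec fun x : ((Code × Bits × ℕ) × ℕ) × (Bits × ℕ) => x.1.1.2.2 :=
    Primrec.snd.comp (Primrec.snd.comp ha)
  have hq : Primrec fun x : ((Code × Bits × ℕ) × ℕ) × (Bits × ℕ) => x.2.1 :=
    Primrec.fst.comp Primrec.snd
  have hk : Primrec fun x : ((Code × Bits × ℕ) × ℕ) × (Bits × ℕ) => x.2.2 :=
    Primrec.snd.comp Primrec.snd
  refine Primrec.cond ?_ ?_ (Primrec.const none)
  · exact (Primrec.eq.comp (Primrec.list_take.comp (Primrec.list_length.comp hp) hq)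
      (Primrec.list_take.comp (Primrec.list_length.comp hq) hp)).decide
  · refine Primrec.option_map (Code.primrec_evaln.comp
      (Primrec.pair (Primrec.pair hk hc) (Primrec.encode.comp (Primrec.pair hq hy)))) ?_
    exact Primrec.pair ((Primrec.eq.comp (hq.comp Primrec.fst) (hp.comp Primrec.fst)).decide)
      Primrec.snd

theorem refMachine_partrec : Partrec₂ refMachine := by
  have h1 : Partrec selfDelim := by
    unfold selfDelim
    refine Partrec.bind (Partrec.rfindOpt probe_primrec.to_comp) ?_
    refine Computable.ofOption ?_
    exact (Primrec.cond (Primrec.fst.comp Primrec.snd)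
      (Primrec.option_some.comp (Primrec.snd.comp Primrec.snd)) (Primrec.const none)).to_comp
  have h2 : Primrec fun x : Bits × ℕ => refArg x.1 x.2 := by
    unfold refArg
    have hi : Primrec fun x : Bits × ℕ => x.1.idxOf false :=
      Primrec.list_idxOf.comp (Primrec.const false) Primrec.fst
    refine Primrec.cond ?_ ?_ (Primrec.const none)
    · exact (Primrec.nat_lt.comp hi (Primrec.list_length.comp Primrec.fst)).decide
    · exact Primrec.option_some.comp (Primrec.pair ((Primrec.ofNat Code).comp hi)
        (Primrec.pair (Primrec.list_drop.comp (Primrec.succ.comp hi) Primrec.fst) Primrec.snd))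
  exact Partrec.bind (Computable.ofOption h2.to_comp) (h1.comp Computable.snd)

theorem mem_probe {c : Code} {p : Bits} {y w o : ℕ} {t : Bool} :
    (t, o) ∈ probe (c, p, y) w ↔ ∃ q k, Encodable.decode (α := Bits × ℕ) w = some (q, k) ∧
      q.take p.length = p.take q.length ∧ o ∈ Code.evaln k c (Encodable.encode (q, y)) ∧
      t = decide (q = p) := by
  unfold probe
  simp only [Option.mem_def, Option.bind_eq_some_iff, Prod.exists]
  refine exists_congr fun q => exists_congr fun k => and_congr_right fun _ => ?_
  by_cases h : q.take p.length = p.take q.length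
  · simp only [h, decide_true, cond_true, Option.map_eq_some_iff, Prod.mk.injEq, true_and]
    constructor
    · rintro ⟨a, h1, h2, rfl⟩; exact ⟨h1, h2.symm⟩
    · rintro ⟨h1, h2⟩; exact ⟨o, h1, h2.symm, rfl⟩
  · simp [h]

theorem mem_selfDelim {c : Code} {p : Bits} {y o : ℕ} :
    o ∈ selfDelim (c, p, y) ↔ ∃ w, (true, o) ∈ probe (c, p, y) w ∧
      ∀ m < w, probe (c, p, y) m = none := by
  unfold selfDelim Nat.rfindOpt
  constructor
  · intro h
    obtain ⟨⟨t, v⟩, h1, ho⟩ := Part.mem_bind_iff.1 h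
    obtain ⟨w, hw, hv⟩ := Part.mem_bind_iff.1 h1
    have hmin : ∀ {m : ℕ}, m < w → _ := (Nat.mem_rfind.1 hw).2
    cases t
    · simp at ho
    · obtain rfl : o = v := by simpa using ho
      refine ⟨w, by simpa using hv, fun m hm => ?_⟩
      simpa using hmin hm
  · rintro ⟨w, hw, hmin⟩
    refine Part.mem_bind_iff.2 ⟨(true, o), Part.mem_bind_iff.2 ⟨w, Nat.mem_rfind.2 ⟨?_, ?_⟩, ?_⟩, ?_⟩
    · rw [Option.mem_def] at hw; simp [hw]
    · intro m hm; simp [hmin m hm]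
    · simpa using hw
    · simp

theorem comparable_of_prefix {p q : Bits} (h : p <+: q) :
    p.take q.length = q.take p.length := by
  obtain ⟨s, rfl⟩ := h
  simp

theorem selfDelim_prefix {c : Code} {p q : Bits} {y : ℕ} (h : p <+: q)
    (hp : (selfDelim (c, p, y)).Dom) (hq : (selfDelim (c, q, y)).Dom) : p = q := by
  obtain ⟨o, ho⟩ := Part.dom_iff_mem.1 hp
  obtain ⟨o', ho'⟩ := Part.dom_iff_mem.1 hq
  obtain ⟨w, hw, hmin⟩ := mem_selfDelim.1 ho
  obtain ⟨w', hw', hmin'⟩ := mem_selfDelim.1 ho'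
  obtain ⟨r, k, h1, -, h3, h4⟩ := mem_probe.1 hw
  obtain ⟨r', k', h1', -, h3', h4'⟩ := mem_probe.1 hw'
  obtain rfl : r = p := by simpa using h4.symm
  obtain rfl : r' = q := by simpa using h4'.symm
  have hcmp := comparable_of_prefix h
  have e1 : w ≤ w' := by
    by_contra hlt
    have := hmin w' (by omega)
    have h5 : (decide (r' = r), o') ∈ probe (c, r, y) w' :=
      mem_probe.2 ⟨r', k', h1', hcmp.symm, h3', rfl⟩
    rw [this] at h5; simp at h5
  have e2 : w' ≤ w := by
    by_contra hlt
    have := hmin' w (by omega)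
    have h5 : (decide (r = r'), o) ∈ probe (c, r', y) w :=
      mem_probe.2 ⟨r, k, h1, hcmp, h3, rfl⟩
    rw [this] at h5; simp at h5
  obtain rfl : w = w' := le_antisymm e1 e2
  rw [h1] at h1'
  simp only [Option.some.injEq, Prod.mk.injEq] at h1'
  exact h1'.1

theorem refArg_some {p : Bits} {y : ℕ} {a : Code × Bits × ℕ} (h : refArg p y = some a) :
    ∃ e s, p = List.replicate e true ++ false :: s ∧ a = (Denumerable.ofNat Code e, s, y) := by
  unfold refArg at h
  by_cases hlt : p.idxOf false < p.length
  · simp only [hlt, decide_true, cond_true, Option.some.injEq] at h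
    refine ⟨p.idxOf false, p.drop (p.idxOf false + 1), ?_, h.symm⟩
    have h1 := List.take_append_drop (p.idxOf false) p
    rw [List.drop_eq_getElem_cons hlt, List.getElem_idxOf hlt] at h1
    have h2 : p.take (p.idxOf false) = List.replicate (p.idxOf false) true := by
      rw [List.eq_replicate_iff]
      refine ⟨by simp [hlt.le], fun b hb => ?_⟩
      cases b
      · exact absurd ((List.mem_take_iff_idxOf_lt (List.mem_of_mem_take hb)).1 hb) (lt_irrefl _)
      · rfl
    rw [h2] at h1
    exact h1.symm
  · simp [hlt] at h

theorem refArg_mk (e : ℕ) (s : Bits) (y : ℕ) :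
    refArg (List.replicate e true ++ false :: s) y = some (Denumerable.ofNat Code e, s, y) := by
  have h : (List.replicate e true ++ false :: s).idxOf false = e := by
    rw [List.idxOf_append_of_notMem (by simp [List.mem_replicate])]
    simp
  unfold refArg
  rw [h]
  simp [List.drop_append]

theorem replicate_prefix {e e' : ℕ} {s s' : Bits}
    (h : List.replicate e true ++ false :: s <+: List.replicate e' true ++ false :: s') :
    e = e' ∧ s <+: s' := by
  induction e generalizing e' with
  | zero =>
    cases e' with
    | zero => simpa [List.cons_prefix_cons] using h
    | succ n => simp [List.replicate_succ, List.cons_prefix_cons] at h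
  | succ m ih =>
    cases e' with
    | zero => simp [List.replicate_succ, List.cons_prefix_cons] at h
    | succ n =>
      simp only [List.replicate_succ, List.cons_append, List.cons_prefix_cons, true_and] at h
      obtain ⟨h1, h2⟩ := ih h
      exact ⟨by omega, h2⟩

/-- Universal prefix machines exist, so that the complexity below is not an empty notion. -/
theorem exists_universalPrefixMachine : ∃ U : Bits → ℕ →. ℕ, IsUniversalPrefixMachine U := by
  refine ⟨refMachine, ⟨refMachine_partrec, ?_⟩, ?_⟩
  · intro y p q hpq hp hq
    obtain ⟨o, ho⟩ := Part.dom_iff_mem.1 hp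
    obtain ⟨o', ho'⟩ := Part.dom_iff_mem.1 hq
    simp only [refMachine, Part.mem_bind_iff, Part.mem_coe] at ho ho'
    obtain ⟨a, ha, hoa⟩ := ho
    obtain ⟨a', ha', hoa'⟩ := ho'
    obtain ⟨e, s, rfl, rfl⟩ := refArg_some ha
    obtain ⟨e', s', rfl, rfl⟩ := refArg_some ha'
    obtain ⟨rfl, hs⟩ := replicate_prefix hpq
    rw [selfDelim_prefix hs (Part.dom_iff_mem.2 ⟨_, hoa⟩) (Part.dom_iff_mem.2 ⟨_, hoa'⟩)]
  · rintro M ⟨hM, hpre⟩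
    obtain ⟨c, hc⟩ := Code.exists_code.1 (show Nat.Partrec _ from hM)
    have heval : ∀ (p : Bits) (y : ℕ), c.eval (Encodable.encode (p, y)) = M p y := by
      intro p y
      rw [hc]
      simp [Part.bind_some, Part.map_id']
    refine ⟨Encodable.encode c + 1, fun p y x hx => ?_⟩
    refine ⟨List.replicate (Encodable.encode c) true ++ false :: p, ?_, ?_⟩
    · simp only [refMachine, refArg_mk, Denumerable.ofNat_encode, Part.coe_some, Part.bind_some]
      have hx' := hx
      rw [← heval, Code.evaln_complete] at hx'
      obtain ⟨k, hk⟩ := hx'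
      have hex : ∃ w, probe (c, p, y) w ≠ none := by
        refine ⟨Encodable.encode (p, k), fun h => ?_⟩
        have : (decide (p = p), x) ∈ probe (c, p, y) (Encodable.encode (p, k)) :=
          mem_probe.2 ⟨p, k, by simp, rfl, hk, rfl⟩
        rw [h] at this; simp at this
      classical
      obtain ⟨⟨t, o⟩, hto⟩ := Option.ne_none_iff_exists'.1 (Nat.find_spec hex)
      have hmem : (t, o) ∈ probe (c, p, y) (Nat.find hex) := hto
      obtain ⟨q, k', -, hcmp, hev, ht⟩ := mem_probe.1 hmem
      have hoq : o ∈ M q y := by rw [← heval]; exact Code.evaln_sound hev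
      have hqp : q = p := by
        rcases le_total p.length q.length with hle | hle
        · rw [List.take_of_length_le (l := p) hle] at hcmp
          have : p <+: q := by rw [← hcmp]; exact List.take_prefix _ _
          exact (hpre y p q this (Part.dom_iff_mem.2 ⟨_, hx⟩) (Part.dom_iff_mem.2 ⟨_, hoq⟩)).symm
        · rw [List.take_of_length_le (l := q) hle] at hcmp
          have : q <+: p := by rw [hcmp]; exact List.take_prefix _ _
          exact hpre y q p this (Part.dom_iff_mem.2 ⟨_, hoq⟩) (Part.dom_iff_mem.2 ⟨_, hx⟩)
      subst hqp
      obtain rfl : o = x := Part.mem_unique hoq hx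
      refine mem_selfDelim.2 ⟨Nat.find hex, ?_, fun m hm => ?_⟩
      · simpa [ht] using hmem
      · have := Nat.find_min hex hm
        simpa using this
    · simp; omega

end Existence

/-! ## The training procedure -/

/-- The software that trains a model. It is a fixed collection of programs; everything that varies
from run to run (architecture, number format, step size, ...) is read off a string, the
architecture. Data elements are strings, and the parameters of a model are machine numbers, which
are rational.

* `numbers a` lists the finite set `𝔽` of machine numbers of architecture `a`;
* `rate a` is the step size `α`;
* `correct a W x` says whether the model with parameters `W` classifies the element `x` correctly;
* `grad a B d W` is the computed (approximate) gradient at `W` of the loss averaged over the batch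
  whose elements, in the order of their ids, are listed in `B`.

The last three fields say that the programs are programs: the number format, the classification
and one gradient step `W - α ∇f_B(W)` can be computed. -/
structure Software where
  numbers : Bits → List ℚ
  rate : Bits → ℚ
  correct : Bits → List ℚ → Bits → Bool
  grad : Bits → List Bits → (d : ℕ) → (Fin d → ℚ) → Fin d → ℚ
  computable_numbers : Computable numbers
  computable_correct : Computable fun q : Bits × List ℚ × Bits => correct q.1 q.2.1 q.2.2
  computable_step : Computable fun q : Bits × List Bits × List ℚ =>
    List.ofFn fun k : Fin q.2.2.length =>
      q.2.2.get k - rate q.1 * grad q.1 q.2.1 q.2.2.length q.2.2.get k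

/-- A vector of machine numbers as a point of `ℝᵈ` with the Euclidean norm. -/
noncomputable def toReal {d : ℕ} (W : Fin d → ℚ) : EuclideanSpace ℝ (Fin d) :=
  WithLp.toLp 2 fun k => (W k : ℝ)

section Training

variable (S : Software) {n d t : ℕ} (arch : Bits) (X : Fin n → Bits)

/-- `W ∈ 𝔽ᵈ`. -/
def IsRepresentable (W : Fin d → ℚ) : Prop := ∀ k, W k ∈ S.numbers arch

/-- The computed gradient of `f_A` at `W`, for a subset `A` of the dataset `X`; the elements of the
dataset are identified by their ids in `Fin n`. -/
def gradOn (A : Finset (Fin n)) (W : Fin d → ℚ) : Fin d → ℚ :=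
  S.grad arch ((A.sort (· ≤ ·)).map X) d W

/-- The computed gradients are `L`-smooth on `𝔽ᵈ`. -/
def IsSmooth (d : ℕ) (L : ℝ) : Prop :=
  ∀ A : Finset (Fin n), A.Nonempty → ∀ W₁ W₂ : Fin d → ℚ,
    IsRepresentable S arch W₁ → IsRepresentable S arch W₂ →
      ‖toReal (gradOn S arch X A W₁) - toReal (gradOn S arch X A W₂)‖ ≤
        L * ‖toReal W₁ - toReal W₂‖

/-- One gradient step on the batch `B`. -/
def gradStep (B : Finset (Fin n)) (W : Fin d → ℚ) : Fin d → ℚ :=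
  fun k => W k - S.rate arch * gradOn S arch X B W k

/-- The `j`-th batch (counted from `0`) of size `b` when the dataset is shuffled by `σ`, where `σ k`
is the element at position `k`. -/
def batch (b : ℕ) (σ : Equiv.Perm (Fin n)) (j : ℕ) : Finset (Fin n) :=
  Finset.univ.filter fun x => (σ.symm x : ℕ) / b = j

/-- The model after the first `j` gradient steps of an epoch that starts with the model `W`. -/
def afterBatches (b : ℕ) (σ : Equiv.Perm (Fin n)) (W : Fin d → ℚ) : ℕ → Fin d → ℚ
  | 0 => W
  | j + 1 => gradStep S arch X (batch b σ j) (afterBatches b σ W j)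

/-- The model at the beginning of epoch `i` (epochs counted from `0`), when epoch `i < t` uses the
permutation `ω i` and the initial model is `W₀`. -/
def epochStart (b : ℕ) (W₀ : Fin d → ℚ) (ω : Fin t → Equiv.Perm (Fin n)) : ℕ → Fin d → ℚ
  | 0 => W₀
  | i + 1 =>
    if h : i < t then afterBatches S arch X b (ω ⟨i, h⟩) (epochStart b W₀ ω i) (n / b)
    else epochStart b W₀ ω i

/-- The model in epoch `i` before the gradient step on batch `j` (both counted from `0`). -/
def model (b : ℕ) (W₀ : Fin d → ℚ) (ω : Fin t → Equiv.Perm (Fin n)) (i : Fin t) (j : ℕ) :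
    Fin d → ℚ :=
  afterBatches S arch X b (ω i) (epochStart S arch X b W₀ ω i) j

/-- The classification function `acc(W, ·)` of a model on the elements of the dataset. -/
def accFun (W : Fin d → ℚ) (x : Fin n) : Bool := S.correct arch (List.ofFn W) (X x)

/-- `acc(W, A)`: the fraction of the elements of `A` that the model classifies correctly. -/
noncomputable def acc (W : Fin d → ℚ) (A : Finset (Fin n)) : ℝ :=
  ((A.filter fun x => accFun S arch X W x = true).card : ℝ) / (A.card : ℝ)

/-- The assumptions on the execution: throughout the first `t` epochs the models stay within machine
precision, the algorithm does not terminate, every epoch makes local progress `β' ε` on average,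
and all models compute simple functions. -/
structure GoodRun (U : Bits → ℕ →. ℕ) (b : ℕ) (ε β' : ℝ) (W₀ : Fin d → ℚ)
    (ω : Fin t → Equiv.Perm (Fin n)) : Prop where
  representable : ∀ i : Fin t, ∀ j < n / b, IsRepresentable S arch (model S arch X b W₀ ω i j)
  not_terminated : ∀ i : Fin t, ∀ j < n / b,
    acc S arch X (model S arch X b W₀ ω i j) Finset.univ < 1 - ε
  local_progress : ∀ i : Fin t, β' * ε < (b : ℝ) / (n : ℝ) * ∑ j ∈ Finset.range (n / b),
    (acc S arch X (model S arch X b W₀ ω i (j + 1)) (batch b (ω i) j) -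
      acc S arch X (model S arch X b W₀ ω i j) (batch b (ω i) j))
  simple : ∀ i : Fin t, ∀ j < n / b,
    (condK U (List.ofFn (accFun S arch X (model S arch X b W₀ ω i j))) (List.ofFn X) : ℝ) ≤
      (n : ℝ) * (β' * ε) ^ 3 / 512

/-- A model as it is given to a machine: the architecture, the parameters, and the indices of the
epoch and of the batch. -/
abbrev ModelCode := Bits × List ℚ × ℕ × ℕ

/-- `K(r_i | X, W_{i+1,1})`: the complexity of the permutation of epoch `i`, written as the list of
the elements in their shuffled order, given the dataset and the model at the end of the epoch. -/
noncomputable def permComplexity (U : Bits → ℕ →. ℕ) (b : ℕ) (W₀ : Fin d → ℚ)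
    (ω : Fin t → Equiv.Perm (Fin n)) (i : Fin t) : ℕ :=
  condK U (List.ofFn fun k => (ω i k : ℕ))
    ((List.ofFn X, (arch, List.ofFn (epochStart S arch X b W₀ ω (i + 1)), (i : ℕ) + 1, 0)) :
      List Bits × ModelCode)

end Training

/-- The probability of the event `E` under the uniform distribution on the finite set `Ω`. -/
noncomputable def uniformProb {Ω : Type} [Fintype Ω] (E : Set Ω) : ℝ :=
  (E.ncard : ℝ) / (Fintype.card Ω : ℝ)

end SGD

/-! The order of an epoch is described by its index in a decidable set of candidates, and this set
is small because the epoch can be run backwards. Since α L < 1, a gradient step is injective on 𝔽ᵈ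
(`gradStep_injective`), so the final model W and the order σ determine all models of the epoch. With
W fixed, the model after a batch is a function of the later batches alone. Expose a uniformly random
σ from the last position to the first: the element at position k is uniform among the elements not
yet exposed, those at positions ≤ k. Hence the sum over k of the correctness, on the element at k,
of the model just trained on its batch, minus its average correctness on the positions ≤ k, is a sum
of martingale differences. By Azuma's inequality at most n! exp(-2s²/n) orders make this sum, the
`advantage`, at least s (`card_advantage_backtrack_le`), and the unknown initial model of the epoch
does not enlarge the count (`card_valid_le`). The logarithm of the count, plus O(log n) bits for the
batch size, the threshold s and self-delimitation, bounds the complexity (`condK_le_log_card`,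
`condK_permList_le`).

It remains to see that a good epoch has advantage at least nβ/4, except with small probability
(`le_advantage`). Local progress compares the models after and before a step on the batch of that
step. The model before the step is independent of the order of the elements to come, so by the
forward exposure martingale it is, on average, about as accurate on its batch as on all of them.
Simple functions are few; by Hoeffding's inequality for sampling without replacement and a union
bound, each of them has almost the same average on every long suffix, on the dataset and on every
long prefix. The averages on the dataset telescope along the epoch. So progress on the batch becomes
an advantage of the new model on its batch over the elements up to there.

The exceptional orders of one epoch, given the earlier epochs, have probability at most 5n
exp(-nβ³/512) (`card_exceptional_le`), and the lower bounds on b and n make the sum over the t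
epochs at most 1/n² (`union_bound`). -/

namespace SGD

/-! ### Azuma's inequality for the exposure of a random bijection. -/

open Finset Real

/-- Hoeffding's lemma for the uniform distribution on `s`: a variable with values in an interval of
length 1 is sub-Gaussian with variance proxy 1/4. It bounds a single step of the martingale. -/
theorem sum_exp_sub_average_le {α : Type*} (s : Finset α) (hs : s.Nonempty) (p : α → ℝ)
    (hp : ∀ x ∈ s, p x ∈ Set.Icc (0 : ℝ) 1) (r : ℝ) :
    ∑ x ∈ s, exp (r * (p x - (∑ y ∈ s, p y) / #s)) ≤ #s * exp (r ^ 2 / 8) := by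
  classical
  have hne : Nonempty s := hs.to_subtype
  let _ : MeasurableSpace s := ⊤
  have hcard : (0 : ℝ) < #s := by exact_mod_cast hs.card_pos
  let μ := (PMF.uniformOfFintype s).toMeasure
  have hint : ∀ f : s → ℝ, ∫ x, f x ∂μ = (∑ x, f x) / #s := by
    intro f
    rw [PMF.integral_eq_sum]
    simp [PMF.uniformOfFintype_apply, div_eq_inv_mul, Finset.mul_sum]
  have h := ProbabilityTheory.hasSubgaussianMGF_of_mem_Icc (μ := μ) (X := fun x : s => p x)
    (a := 0) (b := 1) (Measurable.of_discrete).aemeasurable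
    (Filter.Eventually.of_forall fun x => hp x x.2)
  have h2 := h.mgf_le r
  rw [ProbabilityTheory.mgf, hint, hint, div_le_iff₀ hcard] at h2
  rw [Finset.sum_coe_sort s p,
    Finset.sum_coe_sort s (fun x => exp (r * (p x - (∑ y ∈ s, p y) / #s)))] at h2
  rw [mul_comm (#s : ℝ)]
  refine h2.trans_eq ?_
  congr 2
  push_cast
  norm_num
  ring

theorem average_mem_Icc {α : Type*} (s : Finset α) (p : α → ℝ)
    (hp : ∀ x ∈ s, p x ∈ Set.Icc (0 : ℝ) 1) : (∑ y ∈ s, p y) / #s ∈ Set.Icc (0 : ℝ) 1 := by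
  have h0 : (0 : ℝ) ≤ ∑ y ∈ s, p y := Finset.sum_nonneg fun y hy => (hp y hy).1
  have h1 : ∑ y ∈ s, p y ≤ (#s : ℝ) := by
    simpa using Finset.sum_le_sum fun y hy => (hp y hy).2
  exact ⟨by positivity, div_le_one_of_le₀ h1 (by positivity)⟩

section Exposure

variable {ι α : Type*} [LinearOrder ι] [Fintype ι] [Fintype α] [DecidableEq α]

/-- The value at position `k` minus its average over the positions from `k` on: the increment of a
martingale when a uniformly random bijection is exposed in the order of the positions. -/
noncomputable def increment (p : (ι ≃ α) → ι → α → ℝ) (e : ι ≃ α) (k : ι) : ℝ :=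
  p e k (e k) - (∑ l with k ≤ l, p e k (e l)) / #{l | k ≤ l}

/-- The function used at position `k` depends only on the values at the previous positions. -/
def Predictable (p : (ι ≃ α) → ι → α → ℝ) : Prop :=
  ∀ (e : ι ≃ α) (k a c : ι), k ≤ a → k ≤ c → p ((Equiv.swap a c).trans e) k = p e k

omit [DecidableEq α] [Fintype α] in
-- Exchanging two later positions changes neither the function used at `k`, nor the value at `k`,
-- nor the set of values from `k` on.
theorem increment_swap {p : (ι ≃ α) → ι → α → ℝ} (hp : Predictable p) (e : ι ≃ α) {k a c : ι}
    (ha : k < a) (hc : k < c) :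
    increment p ((Equiv.swap a c).trans e) k = increment p e k := by
  unfold increment
  rw [hp e k a c ha.le hc.le]
  have h1 : ((Equiv.swap a c).trans e) k = e k := by
    simp [Equiv.swap_apply_of_ne_of_ne ha.ne hc.ne]
  have h2 : ∑ l with k ≤ l, p e k (((Equiv.swap a c).trans e) l) =
      ∑ l with k ≤ l, p e k (e l) := by
    refine Finset.sum_equiv (Equiv.swap a c) (fun l => ?_) (fun l _ => rfl)
    simp only [Finset.mem_filter, Finset.mem_univ, true_and]
    by_cases hla : l = a
    · subst hla; simp [ha.le, hc.le]
    · by_cases hlc : l = c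
      · subst hlc; simp [ha.le, hc.le]
      · rw [Equiv.swap_apply_of_ne_of_ne hla hlc]
  rw [h1, h2]

/-- The usual induction over the steps of a martingale, with conditional expectations replaced by
transpositions: exchanging the newest position `k` with any `l ≥ k` permutes the bijections and
preserves all that happened before `k`, so the value at `k` may be averaged over the positions from
`k` on. Induction on the maximum inserts the positions in increasing order. -/
theorem sum_exp_increment_le {p : (ι ≃ α) → ι → α → ℝ} (hp : Predictable p)
    (h01 : ∀ e k x, p e k x ∈ Set.Icc (0 : ℝ) 1) (w : ι → ℝ) (r : ℝ) (s : Finset ι) :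
    ∑ e : ι ≃ α, exp (r * ∑ k ∈ s, w k * increment p e k) ≤
      Fintype.card (ι ≃ α) * exp (r ^ 2 * (∑ k ∈ s, w k ^ 2) / 8) := by
  classical
  induction s using Finset.induction_on_max with
  | empty => simp
  | insert k s hk ih =>
    have hks : k ∉ s := fun h => lt_irrefl _ (hk k h)
    set I : Finset ι := {l | k ≤ l} with hI
    have hkI : k ∈ I := by simp [hI]
    have hIpos : (0 : ℝ) < #I := by exact_mod_cast Finset.card_pos.2 ⟨k, hkI⟩
    set G : (ι ≃ α) → ℝ := fun e => exp (r * ∑ k ∈ s, w k * increment p e k) with hG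
    set a : (ι ≃ α) → ℝ := fun e => (∑ l ∈ I, p e k (e l)) / #I with ha
    have hG0 : ∀ e, 0 ≤ G e := fun e => (exp_pos _).le
    -- Substitute `e ↦ (swap k l).trans e`: the past `G` and the average `a` are invariant, and only
    -- the value at `k` becomes the value at `l`.
    have key : ∀ l ∈ I, ∑ e, G e * exp (r * w k * (p e k (e k) - a e)) =
        ∑ e, G e * exp (r * w k * (p e k (e l) - a e)) := by
      intro l hl
      have hl' : k ≤ l := by simpa [hI] using hl
      refine (Equiv.sum_comp (Equiv.equivCongr (Equiv.swap k l) (Equiv.refl α)) _).symm.trans ?_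
      refine Finset.sum_congr rfl fun e _ => ?_
      have he : (Equiv.equivCongr (Equiv.swap k l) (Equiv.refl α)) e
          = (Equiv.swap k l).trans e := by
        ext x; simp [Equiv.equivCongr]
      rw [he]
      have h1 : G ((Equiv.swap k l).trans e) = G e := by
        simp only [hG]
        congr 2
        refine Finset.sum_congr rfl fun m hm => ?_
        rw [increment_swap hp e (hk m hm) ((hk m hm).trans_le hl')]
      have h2 : a ((Equiv.swap k l).trans e) = a e := by
        simp only [ha]
        rw [hp e k k l le_rfl hl']
        congr 1
        refine Finset.sum_equiv (Equiv.swap k l) (fun m => ?_) (fun m _ => rfl)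
        simp only [hI, Finset.mem_filter, Finset.mem_univ, true_and]
        by_cases hmk : m = k
        · subst hmk; simp [hl']
        · by_cases hml : m = l
          · subst hml; simp [hl']
          · rw [Equiv.swap_apply_of_ne_of_ne hmk hml]
      rw [h1, h2, hp e k k l le_rfl hl']
      simp
    have step : ∑ e, G e * exp (r * w k * (p e k (e k) - a e)) ≤
        ∑ e, G e * exp ((r * w k) ^ 2 / 8) := by
      have h1 : #I * ∑ e, G e * exp (r * w k * (p e k (e k) - a e)) =
          ∑ e, G e * ∑ l ∈ I, exp (r * w k * (p e k (e l) - a e)) := by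
        simp_rw [Finset.mul_sum (s := I)]
        rw [Finset.sum_comm, ← nsmul_eq_mul, ← Finset.sum_const]
        exact Finset.sum_congr rfl fun l hl => key l hl
      have h2 : ∑ e, G e * ∑ l ∈ I, exp (r * w k * (p e k (e l) - a e)) ≤
          ∑ e, G e * (#I * exp ((r * w k) ^ 2 / 8)) := by
        refine Finset.sum_le_sum fun e _ => mul_le_mul_of_nonneg_left ?_ (hG0 e)
        exact sum_exp_sub_average_le I ⟨k, hkI⟩ (fun l => p e k (e l)) (fun l _ => h01 _ _ _) _
      rw [← h1] at h2
      have h3 : ∑ e, G e * (#I * exp ((r * w k) ^ 2 / 8)) =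
          #I * ∑ e, G e * exp ((r * w k) ^ 2 / 8) := by
        rw [Finset.mul_sum]; exact Finset.sum_congr rfl fun e _ => by ring
      rw [h3] at h2
      exact le_of_mul_le_mul_left h2 hIpos
    have e1 : ∑ e : ι ≃ α, exp (r * ∑ k ∈ insert k s, w k * increment p e k) =
        ∑ e, G e * exp (r * w k * (p e k (e k) - a e)) := by
      refine Finset.sum_congr rfl fun e _ => ?_
      rw [Finset.sum_insert hks, hG, ← exp_add]
      congr 1
      simp only [increment, ha, hI]
      ring
    rw [e1]
    refine step.trans ?_
    rw [← Finset.sum_mul, Finset.sum_insert hks]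
    calc _ ≤ (Fintype.card (ι ≃ α) * exp (r ^ 2 * (∑ k ∈ s, w k ^ 2) / 8)) *
        exp ((r * w k) ^ 2 / 8) := mul_le_mul_of_nonneg_right ih (exp_pos _).le
      _ = _ := by rw [mul_assoc, ← exp_add]; congr 2; ring

/-- Azuma's inequality for the exposure martingale. -/
theorem card_increment_ge_le {p : (ι ≃ α) → ι → α → ℝ} (hp : Predictable p)
    (h01 : ∀ e k x, p e k x ∈ Set.Icc (0 : ℝ) 1) (w : ι → ℝ) {v x : ℝ} (hv : 0 < v) (hx : 0 ≤ x)
    (hw : ∑ k, w k ^ 2 ≤ v) (A : Finset (ι ≃ α))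
    (hA : ∀ e ∈ A, x ≤ ∑ k, w k * increment p e k) :
    (#A : ℝ) ≤ Fintype.card (ι ≃ α) * exp (-(2 * x ^ 2 / v)) := by
  -- The minimiser of r²v/8 - rx, with minimum -2x²/v.
  set r : ℝ := 4 * x / v with hr
  have hr0 : 0 ≤ r := by positivity
  have h1 := sum_exp_increment_le hp h01 w r Finset.univ
  have h2 : #A * exp (r * x) ≤ ∑ e : ι ≃ α, exp (r * ∑ k, w k * increment p e k) := by
    rw [← nsmul_eq_mul, ← Finset.sum_const]
    refine (Finset.sum_le_sum fun e he => ?_).trans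
      (Finset.sum_le_univ_sum_of_nonneg fun e => (exp_pos _).le)
    exact exp_le_exp.2 (mul_le_mul_of_nonneg_left (hA e he) hr0)
  have h3 : exp (r ^ 2 * (∑ k, w k ^ 2) / 8) ≤ exp (r ^ 2 * v / 8) :=
    exp_le_exp.2 (by gcongr)
  have h4 : #A * exp (r * x) ≤ Fintype.card (ι ≃ α) * exp (r ^ 2 * v / 8) :=
    h2.trans (h1.trans (mul_le_mul_of_nonneg_left h3 (by positivity)))
  have h5 : (#A : ℝ) = #A * exp (r * x) * exp (-(r * x)) := by
    rw [mul_assoc, ← exp_add]; simp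
  rw [h5]
  calc _ ≤ Fintype.card (ι ≃ α) * exp (r ^ 2 * v / 8) * exp (-(r * x)) :=
        mul_le_mul_of_nonneg_right h4 (exp_pos _).le
    _ = _ := by
      rw [mul_assoc, ← exp_add]
      congr 2
      rw [hr]
      field_simp
      ring

end Exposure

end SGD

/-! ### Deviation bounds for sampling without replacement. -/

namespace SGD

open Finset Real

theorem sum_fin_lt_eq_sum_range {n m : ℕ} (hm : m ≤ n) (g : ℕ → ℝ) :
    ∑ l ∈ {l : Fin n | (l : ℕ) < m}, g l = ∑ i ∈ Finset.range m, g i := by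
  rw [Finset.sum_filter, Fin.sum_univ_eq_sum_range (fun i => if i < m then g i else 0) n,
    ← Finset.sum_filter]
  congr 1
  ext i
  simp only [Finset.mem_filter, Finset.mem_range]
  omega

/-- The martingale behind sampling without replacement. -/
theorem sum_weight_mul_sub_average {n m : ℕ} (hm : m ≤ n) (g : ℕ → ℝ) (l : ℕ) (hl : l ≤ m) :
    ∑ k ∈ Finset.range l, ((n - m : ℝ) / (n - k - 1)) *
        (g k - (∑ i ∈ Finset.range n, g i - ∑ i ∈ Finset.range k, g i) / (n - k)) =
      ∑ i ∈ Finset.range l, g i +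
        (m - l) * ((∑ i ∈ Finset.range n, g i - ∑ i ∈ Finset.range l, g i) / (n - l)) -
        m * ((∑ i ∈ Finset.range n, g i) / n) := by
  induction l with
  | zero => simp
  | succ l ih =>
    rw [Finset.sum_range_succ, ih (by omega), Finset.sum_range_succ (fun i => g i) l]
    set F := ∑ i ∈ Finset.range n, g i with hF
    set h := ∑ i ∈ Finset.range l, g i with hh
    rcases Nat.lt_or_ge (l + 1) n with hlt | hge
    · have h1 : (n : ℝ) - l - 1 ≠ 0 := by
        have : ((l + 1 : ℕ) : ℝ) < n := by exact_mod_cast hlt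
        push_cast at this; intro h; linarith
      have h2 : (n : ℝ) - l ≠ 0 := by
        have : ((l + 1 : ℕ) : ℝ) < n := by exact_mod_cast hlt
        push_cast at this; intro h; linarith
      have h3 : (n : ℝ) - (l + 1) ≠ 0 := by intro h; apply h1; linarith
      push_cast
      have h4 : (n : ℝ) - (l + 1) = n - l - 1 := by ring
      rw [h4]
      field_simp
      ring
    -- Here m = n and the weight of the last position is 0/0 = 0. This is consistent, as the last
    -- value is determined by the previous ones.
    · obtain rfl : n = l + 1 := by omega
      obtain rfl : m = l + 1 := by omega
      have : F = h + g l := by rw [hF, Finset.sum_range_succ]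
      rw [this]
      push_cast
      simp

section Deviation

variable {n : ℕ}

/-- Hoeffding's inequality for a uniformly random sample without replacement. -/
theorem card_prefix_deviation_le {m : ℕ} (hm0 : 0 < m) (hm : m ≤ n) (f : Fin n → ℝ)
    (hf : ∀ x, f x ∈ Set.Icc (0 : ℝ) 1) {δ : ℝ} (hδ : 0 ≤ δ)
    (A : Finset (Equiv.Perm (Fin n)))
    (hA : ∀ σ ∈ A, m * ((∑ x, f x) / n + δ) ≤ ∑ l ∈ {l : Fin n | (l : ℕ) < m}, f (σ l)) :
    (#A : ℝ) ≤ n.factorial * exp (-(2 * δ ^ 2 * m)) := by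
  have hp : Predictable (ι := Fin n) (α := Fin n) (fun _ _ => f) := fun _ _ _ _ _ _ => rfl
  have hm0' : (0 : ℝ) < m := by exact_mod_cast hm0
  -- With these weights the increments sum to the deviation of the prefix sum from its mean. They
  -- are at most 1 and vanish from position `m` on, so the sum of their squares is at most `m`
  -- rather than `n`.
  set w : Fin n → ℝ := fun k => if (k : ℕ) < m then ((n - m : ℝ) / (n - k - 1)) else 0 with hw
  have hsum : ∑ k, w k ^ 2 ≤ (m : ℝ) := by
    have h1 : ∀ k : Fin n, w k ^ 2 ≤ if (k : ℕ) < m then 1 else 0 := by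
      intro k
      simp only [hw]
      split_ifs with h
      · have h2 : ((k : ℕ) : ℝ) + 1 ≤ m := by exact_mod_cast h
        have h3 : (m : ℝ) ≤ n := by exact_mod_cast hm
        have h4 : (n - m : ℝ) / (n - k - 1) ≤ 1 := div_le_one_of_le₀ (by linarith) (by linarith)
        have h5 : 0 ≤ (n - m : ℝ) / (n - k - 1) := div_nonneg (by linarith) (by linarith)
        exact pow_le_one₀ h5 h4
      · simp
    refine (Finset.sum_le_sum fun k _ => h1 k).trans ?_
    rw [← Finset.sum_filter, sum_fin_lt_eq_sum_range hm (fun _ => (1 : ℝ))]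
    simp
  have hfac : Fintype.card (Fin n ≃ Fin n) = n.factorial := by
    simpa using Fintype.card_perm (α := Fin n)
  have hinc : ∀ σ : Equiv.Perm (Fin n),
      ∑ k, w k * increment (ι := Fin n) (α := Fin n) (fun _ _ => f) σ k =
        ∑ l ∈ {l : Fin n | (l : ℕ) < m}, f (σ l) - m * ((∑ x, f x) / n) := by
    intro σ
    set g : ℕ → ℝ := fun i => if h : i < n then f (σ ⟨i, h⟩) else 0 with hg
    have hgl : ∀ l : Fin n, f (σ l) = g l := fun l => by simp [hg]
    have hF : ∑ x, f x = ∑ i ∈ Finset.range n, g i := by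
      rw [← Equiv.sum_comp σ f, ← Fin.sum_univ_eq_sum_range]
      exact Finset.sum_congr rfl fun l _ => hgl l
    have hpre : ∀ k ≤ n, ∑ l ∈ {l : Fin n | (l : ℕ) < k}, f (σ l) = ∑ i ∈ Finset.range k, g i := by
      intro k hk
      rw [← sum_fin_lt_eq_sum_range hk]
      exact Finset.sum_congr rfl fun l _ => hgl l
    have hi : ∀ k : Fin n, increment (ι := Fin n) (α := Fin n) (fun _ _ => f) σ k =
        g k - (∑ i ∈ Finset.range n, g i - ∑ i ∈ Finset.range k, g i) / (n - (k : ℕ)) := by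
      intro k
      unfold increment
      have h1 : ∑ l with k ≤ l, f (σ l) =
          ∑ i ∈ Finset.range n, g i - ∑ i ∈ Finset.range k, g i := by
        rw [← hF, ← hpre k k.2.le, ← Equiv.sum_comp σ f,
          ← Finset.sum_filter_add_sum_filter_not Finset.univ (fun l : Fin n => (l : ℕ) < k)]
        rw [add_sub_cancel_left]
        refine Finset.sum_congr ?_ fun _ _ => rfl
        ext l; simp
      have h2 : (#{l : Fin n | k ≤ l} : ℝ) = n - (k : ℕ) := by
        have : Finset.filter (fun l => k ≤ l) Finset.univ = Finset.Ici k := by ext; simp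
        rw [this, Fin.card_Ici, Nat.cast_sub k.2.le]
      rw [h1, h2]
      beta_reduce
      rw [hgl]
    have hmain := sum_weight_mul_sub_average hm g m le_rfl
    rw [hpre m hm, hF]
    have e : ∑ k, w k * increment (ι := Fin n) (α := Fin n) (fun _ _ => f) σ k =
        ∑ k ∈ Finset.range m, ((n - m : ℝ) / (n - k - 1)) *
        (g k - (∑ i ∈ Finset.range n, g i - ∑ i ∈ Finset.range k, g i) / (n - k)) := by
      rw [← sum_fin_lt_eq_sum_range hm, Finset.sum_filter]
      refine Finset.sum_congr rfl fun k _ => ?_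
      rw [hi]
      simp only [hw]
      split_ifs <;> simp
    rw [e, hmain]
    ring
  have := card_increment_ge_le hp (fun _ _ x => hf x) w hm0' (x := δ * m) (by positivity) hsum A
    (fun σ hσ => by have := hA σ hσ; rw [hinc]; linarith)
  rw [hfac] at this
  convert this using 4
  field_simp

/-- Reversing the positions and passing from `f` to `1 - f` turns a small suffix sum into a large
prefix sum of length `n - k`. -/
theorem card_suffix_deviation_le {k : ℕ} (hk : k < n) (f : Fin n → ℝ)
    (hf : ∀ x, f x ∈ Set.Icc (0 : ℝ) 1) {δ : ℝ} (hδ : 0 ≤ δ)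
    (A : Finset (Equiv.Perm (Fin n)))
    (hA : ∀ σ ∈ A, ∑ l ∈ {l : Fin n | k ≤ (l : ℕ)}, f (σ l) ≤ (n - k) * ((∑ x, f x) / n - δ)) :
    (#A : ℝ) ≤ n.factorial * exp (-(2 * δ ^ 2 * (n - k))) := by
  classical
  have hn : (n : ℝ) ≠ 0 := by have : 0 < n := by omega
                              positivity
  have hcast : ((n - k : ℕ) : ℝ) = n - k := Nat.cast_sub hk.le
  rw [← hcast, ← Finset.card_map (Equiv.mulRight Fin.revPerm).toEmbedding]
  refine card_prefix_deviation_le (by omega) (Nat.sub_le _ _) (fun x => 1 - f x)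
    (fun x => ⟨by linarith [(hf x).2], by linarith [(hf x).1]⟩) hδ _ ?_
  intro τ hτ
  obtain ⟨σ, hσ, rfl⟩ := Finset.mem_map.1 hτ
  have h := hA σ hσ
  have e : ∑ l ∈ {l : Fin n | (l : ℕ) < n - k},
      (1 - f (((Equiv.mulRight Fin.revPerm).toEmbedding σ) l)) =
      ∑ l ∈ {l : Fin n | k ≤ (l : ℕ)}, (1 - f (σ l)) := by
    refine Finset.sum_equiv Fin.revPerm (fun l => ?_) (fun l _ => ?_)
    · simp only [Finset.mem_filter, Finset.mem_univ, true_and, Fin.revPerm_apply, Fin.val_rev]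
      omega
    · simp
  have hc : (#{l : Fin n | k ≤ (l : ℕ)} : ℝ) = n - k := by
    have : Finset.filter (fun l : Fin n => k ≤ (l : ℕ)) Finset.univ = Finset.Ici ⟨k, hk⟩ := by
      ext l; simp [Fin.le_def]
    rw [this, Fin.card_Ici, ← hcast]
  rw [e, Finset.sum_sub_distrib, Finset.sum_sub_distrib, hcast]
  simp only [Finset.sum_const, nsmul_eq_mul, mul_one, hc, Finset.card_univ, Fintype.card_fin]
  rw [sub_div, div_self hn]
  linarith

end Deviation

end SGD

/-! ### Self-delimiting codes of numbers. -/

namespace SGD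

open Encodable

section BitStrings

/-- The number whose binary expansion is `1` followed by the string. -/
def bitsVal (w : Bits) : ℕ := w.foldl (fun a b => 2 * a + bif b then 1 else 0) 1

theorem bitsVal_concat (w : Bits) (b : Bool) :
    bitsVal (w ++ [b]) = 2 * bitsVal w + bif b then 1 else 0 := by
  simp [bitsVal]

theorem bitsVal_mem (w : Bits) : 2 ^ w.length ≤ bitsVal w ∧ bitsVal w < 2 ^ (w.length + 1) := by
  induction w using List.reverseRecOn with
  | nil => simp [bitsVal]
  | append_singleton w b ih =>
    rw [bitsVal_concat, List.length_append, List.length_singleton, pow_succ _ (w.length + 1)]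
    have h : (2 : ℕ) ^ (w.length + 1) = 2 * 2 ^ w.length := by ring
    cases b <;> simp only [cond_true, cond_false] <;> omega

theorem bitsVal_injective : Function.Injective bitsVal := by
  intro w
  induction w using List.reverseRecOn with
  | nil =>
    intro w' h
    rcases List.eq_nil_or_concat w' with rfl | ⟨v, b, rfl⟩
    · rfl
    · have h1 : bitsVal [] = 1 := rfl
      have h2 := (bitsVal_mem v).1
      have h3 : 0 < 2 ^ v.length := by positivity
      rw [h1, List.concat_eq_append, bitsVal_concat] at h
      omega
  | append_singleton w b ih =>
    intro w' h
    rcases List.eq_nil_or_concat w' with rfl | ⟨v, b', rfl⟩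
    · have h1 : bitsVal [] = 1 := rfl
      have h2 := (bitsVal_mem w).1
      have h3 : 0 < 2 ^ w.length := by positivity
      rw [h1, bitsVal_concat] at h
      omega
    · rw [List.concat_eq_append, bitsVal_concat, bitsVal_concat] at h
      have hb : b = b' := by cases b <;> cases b' <;> simp_all <;> omega
      subst hb
      rw [@ih v (by omega), List.concat_eq_append]

theorem exists_bitsVal_eq (v : ℕ) : ∃ w : Bits, bitsVal w = v + 1 ∧ w.length = Nat.log 2 (v + 1) := by
  have hex : ∃ w : Bits, bitsVal w = v + 1 := by
    induction v using Nat.strong_induction_on with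
    | _ v ih =>
      rcases Nat.eq_zero_or_pos v with rfl | hv
      · exact ⟨[], rfl⟩
      · obtain ⟨w, hw⟩ := ih ((v + 1) / 2 - 1) (by omega)
        refine ⟨w ++ [decide ((v + 1) % 2 = 1)], ?_⟩
        rw [bitsVal_concat, hw]
        rcases Nat.mod_two_eq_zero_or_one (v + 1) with h | h <;> simp [h] <;> omega
  obtain ⟨w, hw⟩ := hex
  refine ⟨w, hw, ?_⟩
  have := bitsVal_mem w
  rw [hw] at this
  exact ((Nat.log_eq_iff (Or.inr ⟨one_lt_two, by omega⟩)).2 this).symm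

theorem bitsVal_primrec : Primrec bitsVal := by
  unfold bitsVal
  have h1 : Primrec fun x : Bits × ℕ × Bool => x.2.1 := Primrec.fst.comp Primrec.snd
  have h2 : Primrec fun x : Bits × ℕ × Bool => x.2.2 := Primrec.snd.comp Primrec.snd
  refine Primrec.list_foldl (h := fun (_ : Bits) (x : ℕ × Bool) => 2 * x.1 + bif x.2 then 1 else 0)
    Primrec.id (Primrec.const 1) ?_
  exact Primrec.nat_add.comp (Primrec.nat_mul.comp (Primrec.const 2) h1)
    (Primrec.cond h2 (Primrec.const 1) (Primrec.const 0))

/-- A self-delimiting code of the numbers: the string `w` of a number is preceded by the string of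
the length of `w`, which is in turn preceded by its own length in unary. -/
def parseNat (p : Bits) : Option ℕ :=
  -- For a code made of |u| ones, a zero, `u` and `w`, where `bitsVal u = |w| + 1`, the total length
  -- is 2|u| + 1 + |w| = 2|u| + `bitsVal u`.
  if p.idxOf false < p.length ∧ p.length =
      2 * p.idxOf false + bitsVal ((p.drop (p.idxOf false + 1)).take (p.idxOf false)) then
    some (bitsVal (p.drop (2 * p.idxOf false + 1)) - 1)
  else none

theorem parseNat_primrec : Primrec parseNat := by
  unfold parseNat
  have hi : Primrec fun p : Bits => p.idxOf false :=
    Primrec.list_idxOf.comp (Primrec.const false) Primrec.id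
  have h2i : Primrec fun p : Bits => 2 * p.idxOf false := Primrec.nat_mul.comp (Primrec.const 2) hi
  refine Primrec.ite ?_ ?_ (Primrec.const none)
  · refine (Primrec.nat_lt.comp hi Primrec.list_length).and
      (Primrec.eq.comp Primrec.list_length (Primrec.nat_add.comp h2i ?_))
    exact bitsVal_primrec.comp (Primrec.list_take.comp hi
      (Primrec.list_drop.comp (Primrec.succ.comp hi) Primrec.id))
  · exact Primrec.option_some.comp (Primrec.pred.comp (bitsVal_primrec.comp
      (Primrec.list_drop.comp (Primrec.succ.comp h2i) Primrec.id)))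

theorem parseNat_isSome {p : Bits} : (parseNat p).isSome ↔ p.idxOf false < p.length ∧
    p.length = 2 * p.idxOf false +
      bitsVal ((p.drop (p.idxOf false + 1)).take (p.idxOf false)) := by
  unfold parseNat
  split_ifs with h
  · exact iff_of_true rfl h
  · exact iff_of_false (by simp) h

/-- The unary part and the block after it fix the length of a code. Both already lie in the shorter
string, so the two lengths agree. -/
theorem parseNat_prefix {p q : Bits} (h : p <+: q) (hp : (parseNat p).isSome)
    (hq : (parseNat q).isSome) : p = q := by
  obtain ⟨hp1, hp2⟩ := parseNat_isSome.1 hp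
  obtain ⟨-, hq2⟩ := parseNat_isSome.1 hq
  refine h.eq_of_length ?_
  obtain ⟨s, rfl⟩ := h
  have hi : (p ++ s).idxOf false = p.idxOf false :=
    List.idxOf_append_of_mem (List.idxOf_lt_length_iff.1 hp1)
  rw [hi] at hq2
  have hpos : 0 < bitsVal ((p.drop (p.idxOf false + 1)).take (p.idxOf false)) :=
    lt_of_lt_of_le (by positivity) (bitsVal_mem _).1
  rw [List.drop_append_of_le_length (by omega), List.take_append_of_le_length (by simp; omega)]
    at hq2
  omega

theorem exists_parseNat_eq (v : ℕ) : ∃ p : Bits, parseNat p = some v ∧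
    p.length ≤ Nat.log 2 (v + 1) + 2 * Nat.log 2 (Nat.log 2 (v + 1) + 1) + 1 := by
  obtain ⟨w, hw, hwl⟩ := exists_bitsVal_eq v
  obtain ⟨u, hu, hul⟩ := exists_bitsVal_eq w.length
  refine ⟨List.replicate u.length true ++ false :: (u ++ w), ?_, ?_⟩
  · set p := List.replicate u.length true ++ false :: (u ++ w) with hp
    have hi : p.idxOf false = u.length := by
      rw [hp, List.idxOf_append_of_notMem (by simp [List.mem_replicate])]
      simp
    have hlen : p.length = 2 * u.length + 1 + w.length := by rw [hp]; simp; omega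
    have hd1 : p.drop (u.length + 1) = u ++ w := by simp [hp, List.drop_append]
    have hd2 : p.drop (2 * u.length + 1) = w := by
      have : p.drop (2 * u.length + 1) = (p.drop (u.length + 1)).drop u.length := by
        rw [List.drop_drop]; congr 1; omega
      rw [this, hd1]; simp
    have hcond : p.idxOf false < p.length ∧ p.length =
        2 * p.idxOf false + bitsVal ((p.drop (p.idxOf false + 1)).take (p.idxOf false)) := by
      rw [hi, hd1, hlen]
      simp [hu]
      omega
    unfold parseNat
    rw [if_pos hcond, hi, hd2, hw]
    simp
  · simp only [List.length_append, List.length_replicate, List.length_cons]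
    rw [← hwl, ← hul]
    omega

end BitStrings

theorem computable_decide_eq : Computable₂ fun a b : ℕ => decide (a = b) :=
  (Primrec.eq (α := ℕ)).decide.to_comp

theorem computable_and : Computable₂ and := Primrec.and.to_comp

theorem computable_add : Computable₂ ((· + ·) : ℕ → ℕ → ℕ) := Primrec.nat_add.to_comp

theorem computable_mul : Computable₂ ((· * ·) : ℕ → ℕ → ℕ) := Primrec.nat_mul.to_comp

theorem computable_div : Computable₂ ((· / ·) : ℕ → ℕ → ℕ) := Primrec.nat_div.to_comp

theorem computable_mod : Computable₂ ((· % ·) : ℕ → ℕ → ℕ) := Primrec.nat_mod.to_comp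

theorem computable_decide_lt : Computable₂ fun a b : ℕ => decide (a < b) :=
  Primrec.nat_lt.decide.to_comp

/-! ### Upper bounds and counting for conditional complexity. -/

section Complexity

variable {U : Bits → ℕ →. ℕ}

/-- The universal machine simulates the prefix machine that parses a number `v` and runs `f v`; the
price is the length of the self-delimiting code of `v` and a constant. -/
theorem exists_program_le (hU : IsUniversalPrefixMachine U) {f : ℕ → ℕ →. ℕ} (hf : Partrec₂ f) :
    ∃ c : ℕ, ∀ v y x : ℕ, x ∈ f v y → ∃ p : Bits, x ∈ U p y ∧
      p.length ≤ Nat.log 2 (v + 1) + 2 * Nat.log 2 (Nat.log 2 (v + 1) + 1) + c := by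
  set M : Bits → ℕ →. ℕ := fun p y => ((parseNat p : Option ℕ) : Part ℕ).bind fun v => f v y
    with hM
  have hMp : IsPrefixMachine M := by
    refine ⟨?_, ?_⟩
    · refine Partrec.bind (Computable.ofOption (parseNat_primrec.to_comp.comp Computable.fst)) ?_
      exact hf.comp Computable.snd (Computable.snd.comp Computable.fst)
    · intro y p q hpq hp hq
      have hd : ∀ r : Bits, (M r y).Dom → (parseNat r).isSome := by
        intro r hr
        obtain ⟨o, ho⟩ := Part.dom_iff_mem.1 hr
        obtain ⟨v, hv, -⟩ := Part.mem_bind_iff.1 ho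
        rw [Part.mem_coe, Option.mem_def] at hv
        simp [hv]
      exact parseNat_prefix hpq (hd p hp) (hd q hq)
  obtain ⟨c, hc⟩ := hU.2 M hMp
  refine ⟨c + 1, fun v y x hx => ?_⟩
  obtain ⟨p, hp, hpl⟩ := exists_parseNat_eq v
  obtain ⟨q, hq, hql⟩ := hc p y x (by simpa [hM, hp] using hx)
  exact ⟨q, hq, by omega⟩

theorem condK_le_of_partrec (hU : IsUniversalPrefixMachine U) {f : ℕ → ℕ →. ℕ}
    (hf : Partrec₂ f) : ∃ c : ℕ, ∀ {α β : Type} [Primcodable α] [Primcodable β] (x : α) (y : β)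
      (v : ℕ), encode x ∈ f v (encode y) →
        condK U x y ≤ Nat.log 2 (v + 1) + 2 * Nat.log 2 (Nat.log 2 (v + 1) + 1) + c := by
  obtain ⟨c, hc⟩ := exists_program_le hU hf
  refine ⟨c, fun {α β} _ _ x y v hx => ?_⟩
  obtain ⟨p, hp, hpl⟩ := hc v _ _ hx
  have hm : p.length ∈ {m : ℕ | ∃ p : Bits, p.length = m ∧ encode x ∈ U p (encode y)} :=
    ⟨p, rfl, hp⟩
  exact (Nat.sInf_le hm).trans hpl

/-- Some program prints any given object, so the infimum in `condK` is attained and is not the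
default value 0 of an empty set. Without this, counting objects by their programs would fail. -/
theorem exists_program_length_eq_condK (hU : IsUniversalPrefixMachine U) {α β : Type}
    [Primcodable α] [Primcodable β] (x : α) (y : β) :
    ∃ p : Bits, p.length = condK U x y ∧ encode x ∈ U p (encode y) := by
  obtain ⟨c, hc⟩ := exists_program_le hU (f := fun v _ => Part.some v)
    (Computable.fst : Computable fun q : ℕ × ℕ => q.1)
  obtain ⟨p, hp, -⟩ := hc (encode x) (encode y) (encode x) (Part.mem_some _)
  exact Nat.sInf_mem (s := {m : ℕ | ∃ p : Bits, p.length = m ∧ encode x ∈ U p (encode y)})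
    ⟨p.length, p, rfl, hp⟩

/-- There are few objects of small complexity. -/
theorem card_le_of_condK_le (hU : IsUniversalPrefixMachine U) {α β : Type}
    [Primcodable α] [Primcodable β] (y : β) (s : ℕ) (A : Finset α)
    (hA : ∀ x ∈ A, condK U x y ≤ s) : A.card ≤ 2 ^ (s + 1) := by
  choose p hp hpU using fun x : α => exists_program_length_eq_condK hU x y
  rw [← Finset.card_range (2 ^ (s + 1))]
  refine Finset.card_le_card_of_injOn (fun x => bitsVal (p x)) (fun x hx => ?_) ?_
  · simp only [Finset.coe_range, Set.mem_Iio]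
    refine (bitsVal_mem _).2.trans_le (Nat.pow_le_pow_right two_pos ?_)
    rw [hp]
    have := hA x hx
    omega
  · intro x _ x' _ h
    have h1 : p x = p x' := bitsVal_injective h
    have h2 := hpU x'
    rw [← h1] at h2
    exact encode_injective (Part.mem_unique (hpU x) h2)

section Selection

variable {α β γ : Type} [Primcodable α] [Primcodable β] [Primcodable γ]

/-- The object with code `z`, if it has the property `P`. -/
def selectCode (P : β × ℕ × α → Bool) (a : β × ℕ) (z : ℕ) : Option α :=
  -- Several numbers may decode to the same object; only its standard code is accepted, so that no
  -- object is counted twice.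
  (decode (α := α) z).bind fun x => bif P (a.1, a.2, x) && decide (encode x = z) then some x else none

/-- The number of objects with the property `P` whose codes are below `z`. -/
def countCode (P : β × ℕ × α → Bool) (a : β × ℕ) (z : ℕ) : ℕ :=
  Nat.rec 0 (fun i r => r + bif (selectCode P a i).isSome then 1 else 0) z

omit [Primcodable β] in
theorem selectCode_eq_some {P : β × ℕ × α → Bool} {a : β × ℕ} {z : ℕ} {x : α} :
    selectCode P a z = some x ↔ encode x = z ∧ P (a.1, a.2, x) = true := by
  unfold selectCode
  rw [Option.bind_eq_some_iff]
  constructor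
  · rintro ⟨x', h1, h2⟩
    cases hb : P (a.1, a.2, x') && decide (encode x' = z)
    · simp [hb] at h2
    · simp only [hb, cond_true, Option.some.injEq] at h2
      subst h2
      simp only [Bool.and_eq_true, decide_eq_true_eq] at hb
      exact ⟨hb.2, hb.1⟩
  · rintro ⟨rfl, h⟩
    exact ⟨x, by simp, by simp [h]⟩

theorem selectCode_computable {P : β × ℕ × α → Bool} (hP : Computable P) :
    Computable₂ (selectCode P) := by
  unfold selectCode
  have hz : Computable fun x : (β × ℕ) × ℕ => decode (α := α) x.2 :=
    Computable.decode.comp Computable.snd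
  refine Computable.option_bind hz ?_
  have ha : Computable fun x : ((β × ℕ) × ℕ) × α => x.1.1 := Computable.fst.comp Computable.fst
  refine Computable.cond (computable_and.comp (hP.comp ?_) ?_)
    (Computable.option_some.comp Computable.snd) (Computable.const none)
  · exact Computable.pair (Computable.fst.comp ha)
      (Computable.pair (Computable.snd.comp ha) Computable.snd)
  · have h1 : Computable fun x : ((β × ℕ) × ℕ) × α => encode x.2 :=
      Computable.encode.comp Computable.snd
    have h2 : Computable fun x : ((β × ℕ) × ℕ) × α => x.1.2 := Computable.snd.comp Computable.fst
    exact computable_decide_eq.comp h1 h2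

theorem countCode_computable {P : β × ℕ × α → Bool} (hP : Computable P) :
    Computable₂ (countCode P) := by
  unfold countCode
  have h2 : Computable fun x : ((β × ℕ) × ℕ) × ℕ × ℕ => x.1.1 :=
    Computable.fst.comp Computable.fst
  have h3 : Computable fun x : ((β × ℕ) × ℕ) × ℕ × ℕ => x.2.1 :=
    Computable.fst.comp Computable.snd
  have hz : Computable fun x : (β × ℕ) × ℕ => x.2 := Computable.snd
  refine Computable.nat_rec (h := fun (x : (β × ℕ) × ℕ) (r : ℕ × ℕ) =>
    r.2 + bif (selectCode P x.1 r.1).isSome then 1 else 0) hz (Computable.const 0) ?_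
  have h1 : Computable fun x : ((β × ℕ) × ℕ) × ℕ × ℕ => x.2.2 := Computable.snd.comp Computable.snd
  refine computable_add.comp h1 (Computable.cond ?_ (Computable.const 1)
    (Computable.const 0))
  exact Primrec.option_isSome.to_comp.comp ((selectCode_computable hP).comp h2 h3)

omit [Primcodable β] in
theorem countCode_succ (P : β × ℕ × α → Bool) (a : β × ℕ) (z : ℕ) : countCode P a (z + 1) =
    countCode P a z + bif (selectCode P a z).isSome then 1 else 0 := rfl

omit [Primcodable β] in
theorem countCode_mono (P : β × ℕ × α → Bool) (a : β × ℕ) : Monotone (countCode P a) :=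
  monotone_nat_of_le_succ fun z => by rw [countCode_succ]; omega

omit [Primcodable β] in
theorem exists_finset_card_eq_countCode (P : β × ℕ × α → Bool) (a : β × ℕ) (z : ℕ) :
    ∃ A : Finset α, A.card = countCode P a z ∧ ∀ x ∈ A, P (a.1, a.2, x) = true ∧ encode x < z := by
  classical
  induction z with
  | zero => exact ⟨∅, rfl, by simp⟩
  | succ z ih =>
    obtain ⟨A, hA, hAP⟩ := ih
    rw [countCode_succ]
    cases h : selectCode P a z with
    | none => exact ⟨A, by simp [hA], fun x hx => ⟨(hAP x hx).1, by have := (hAP x hx).2; omega⟩⟩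
    | some x =>
      obtain ⟨h1, h2⟩ := selectCode_eq_some.1 h
      refine ⟨insert x A, ?_, ?_⟩
      · rw [Finset.card_insert_of_notMem (fun hx => by have := (hAP x hx).2; omega), hA]
        simp
      · intro x' hx'
        rcases Finset.mem_insert.1 hx' with rfl | hx'
        · exact ⟨h2, by omega⟩
        · exact ⟨(hAP x' hx').1, by have := (hAP x' hx').2; omega⟩

/-- An object in a decidable set of `N` objects can be described by its index, together with the
parameter `m < Q y` that defines the set. -/
theorem condK_le_log_card (hU : IsUniversalPrefixMachine U) {P : β × ℕ × α → Bool}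
    (hP : Computable P) {Q : β → ℕ} (hQ : Computable Q) {g : α → γ} (hg : Computable g) :
    ∃ c : ℕ, ∀ (y : β) (m N : ℕ) (x : α), m < Q y → P (y, m, x) = true →
      (∀ A : Finset α, (∀ x ∈ A, P (y, m, x) = true) → A.card ≤ N) →
        condK U (g x) y ≤
          Nat.log 2 (N * Q y) + 2 * Nat.log 2 (Nat.log 2 (N * Q y) + 1) + c := by
  -- One number carries both data: the quotient by `Q y` is the index and the remainder is the
  -- parameter.
  set F : (ℕ × β) → ℕ → Option ℕ := fun q z =>
    (selectCode P (q.2, q.1 % Q q.2) z).bind fun x =>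
      bif decide (countCode P (q.2, q.1 % Q q.2) z = q.1 / Q q.2) then some (encode (g x)) else none
    with hF
  have hFc : Computable₂ F := by
    have hq : Computable fun w : (ℕ × β) × ℕ => (w.1.2, w.1.1 % Q w.1.2) :=
      Computable.pair (Computable.snd.comp Computable.fst)
        (computable_mod.comp (Computable.fst.comp Computable.fst)
          (hQ.comp (Computable.snd.comp Computable.fst)))
    have hd : Computable fun w : (ℕ × β) × ℕ => w.1.1 / Q w.1.2 :=
      computable_div.comp (Computable.fst.comp Computable.fst)
          (hQ.comp (Computable.snd.comp Computable.fst))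
    refine Computable.option_bind ((selectCode_computable hP).comp hq Computable.snd) ?_
    refine Computable.cond ?_ ?_ (Computable.const none)
    · have h1 : Computable fun w : ((ℕ × β) × ℕ) × α =>
          countCode P (w.1.1.2, w.1.1.1 % Q w.1.1.2) w.1.2 :=
        ((countCode_computable hP).comp hq Computable.snd).comp Computable.fst
      have h2 : Computable fun w : ((ℕ × β) × ℕ) × α => w.1.1.1 / Q w.1.1.2 :=
        hd.comp Computable.fst
      exact computable_decide_eq.comp h1 h2
    · exact Computable.option_some.comp (Computable.encode.comp (hg.comp Computable.snd))
  set f : ℕ → ℕ →. ℕ := fun v y => ((decode (α := β) y : Option β) : Part β).bind fun y' =>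
    Nat.rfindOpt (F (v, y')) with hf
  have hfp : Partrec₂ f := by
    have hy : Computable fun x : ℕ × ℕ => decode (α := β) x.2 :=
      Computable.decode.comp Computable.snd
    have hvy : Computable fun x : (ℕ × ℕ) × β => (x.1.1, x.2) :=
      Computable.pair (Computable.fst.comp Computable.fst) Computable.snd
    exact Partrec.bind (Computable.ofOption hy) ((Partrec.rfindOpt hFc).comp hvy)
  obtain ⟨c, hc⟩ := condK_le_of_partrec hU hfp
  refine ⟨c, fun y m N x hm hx hN => ?_⟩
  set i := countCode P (y, m) (encode x) with hi
  have hsel : selectCode P (y, m) (encode x) = some x := selectCode_eq_some.2 ⟨rfl, hx⟩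
  have hQ0 : 0 < Q y := by omega
  -- Counting up to and including the code of `x` yields `i + 1` objects with the property.
  have hiN : i < N := by
    obtain ⟨A, hA, hAP⟩ := exists_finset_card_eq_countCode P (y, m) (encode x + 1)
    rw [countCode_succ, hsel] at hA
    have := hN A fun x hx => (hAP x hx).1
    simp only [Option.isSome_some, cond_true] at hA
    omega
  have hmod : (i * Q y + m) % Q y = m := by
    rw [Nat.mul_add_mod_self_right, Nat.mod_eq_of_lt hm]
  have hdiv : (i * Q y + m) / Q y = i := by
    rw [Nat.div_eq_of_lt_le] <;> nlinarith
  have hmem : encode (g x) ∈ f (i * Q y + m) (encode y) := by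
    have hFx : F (i * Q y + m, y) (encode x) = some (encode (g x)) := by
      simp only [hF, hmod, hdiv, hsel, Option.bind_some, ← hi, decide_true, cond_true]
    simp only [hf, encodek, Part.coe_some, Part.bind_some]
    have hdom : (Nat.rfindOpt (F (i * Q y + m, y))).Dom :=
      Nat.rfindOpt_dom.2 ⟨_, _, hFx⟩
    obtain ⟨o, ho⟩ := Part.dom_iff_mem.1 hdom
    obtain ⟨z, hz⟩ := Nat.rfindOpt_spec ho
    have : o = encode (g x) := by
      simp only [hF, hmod, hdiv, Option.mem_def, Option.bind_eq_some_iff] at hz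
      obtain ⟨x', hx', h2⟩ := hz
      by_cases hcnt : countCode P (y, m) z = i
      · simp only [hcnt, decide_true, cond_true, Option.some.injEq] at h2
        -- The count increases right after every accepted code, so two accepted codes with the same
        -- count coincide.
        have hzx : z = encode x := by
          rcases lt_trichotomy z (encode x) with h | h | h
          · have h3 := countCode_mono P (y, m) (Nat.succ_le_of_lt h)
            rw [Nat.succ_eq_add_one, countCode_succ, hx'] at h3
            simp at h3; omega
          · exact h
          · have h3 := countCode_mono P (y, m) (Nat.succ_le_of_lt h)
            rw [Nat.succ_eq_add_one, countCode_succ, hsel] at h3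
            simp at h3; omega
        rw [hzx, hsel] at hx'
        obtain rfl : x = x' := by simpa using hx'
        exact h2.symm
      · simp [hcnt] at h2
    rwa [← this]
  have hv : i * Q y + m + 1 ≤ N * Q y := by nlinarith
  have hl1 : Nat.log 2 (i * Q y + m + 1) ≤ Nat.log 2 (N * Q y) := Nat.log_mono_right hv
  have hl2 : Nat.log 2 (Nat.log 2 (i * Q y + m + 1) + 1) ≤ Nat.log 2 (Nat.log 2 (N * Q y) + 1) :=
    Nat.log_mono_right (by omega)
  have := hc (g x) y _ hmem
  omega

end Selection

end Complexity

end SGD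

/-! ### The decidable test by which the decoder recognises candidates. -/

namespace SGD

open Encodable

section Computability

variable {α : Type} [Primcodable α]

theorem computable_sum {f : α → ℕ → ℕ} {g : α → ℕ} (hf : Computable₂ f) (hg : Computable g) :
    Computable fun a => ∑ i ∈ Finset.range (g a), f a i := by
  have h1 : Computable fun x : α × ℕ × ℕ => x.1 := Computable.fst
  have h2 : Computable fun x : α × ℕ × ℕ => x.2.1 := Computable.fst.comp Computable.snd
  have h3 : Computable fun x : α × ℕ × ℕ => x.2.2 := Computable.snd.comp Computable.snd
  have h := Computable.nat_rec (h := fun a (r : ℕ × ℕ) => r.2 + f a r.1) hg (Computable.const 0)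
    (computable_add.comp h3 (hf.comp h1 h2))
  refine h.of_eq fun a => ?_
  induction g a with
  | zero => rfl
  | succ n ih => rw [Finset.sum_range_succ, ← ih]

theorem computable_factorial : Computable Nat.factorial := by
  have h2 : Computable fun x : ℕ × ℕ × ℕ => x.2.1 := Computable.fst.comp Computable.snd
  have h3 : Computable fun x : ℕ × ℕ × ℕ => x.2.2 := Computable.snd.comp Computable.snd
  have h := Computable.nat_rec (h := fun (_ : ℕ) (r : ℕ × ℕ) => (r.1 + 1) * r.2) Computable.id
    (Computable.const 1) (computable_mul.comp (Computable.succ.comp h2) h3)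
  refine h.of_eq fun a => ?_
  induction a with
  | zero => rfl
  | succ n ih => rw [Nat.factorial_succ, ← ih]; rfl

theorem computable_toNat : Computable Bool.toNat :=
  (Computable.cond Computable.id (Computable.const 1) (Computable.const 0)).of_eq
    fun b => by cases b <;> rfl

theorem computable_not : Computable not := Primrec.not.to_comp

end Computability

/-- One gradient step, on lists. -/
def stepList (S : Software) (q : Bits × List Bits × List ℚ) : List ℚ :=
  List.ofFn fun k : Fin q.2.2.length =>
    q.2.2.get k - S.rate q.1 * S.grad q.1 q.2.1 q.2.2.length q.2.2.get k

theorem stepList_computable (S : Software) : Computable (stepList S) := S.computable_step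

/-- Classification, on triples. -/
def classify (S : Software) (q : Bits × List ℚ × Bits) : Bool := S.correct q.1 q.2.1 q.2.2

theorem classify_computable (S : Software) : Computable (classify S) := S.computable_correct

/-- A candidate of the decoder: the condition (the dataset and the final model of the epoch), the
parameter (which encodes the batch size and a threshold), a permutation as a list of numbers, and
the parameters of the model at the start of the epoch. -/
abbrev Candidate := (List Bits × ModelCode) × ℕ × List ℕ × List ℚ

namespace Candidate

variable (S : Software) (c : Candidate)

def size : ℕ := c.1.1.length

/-- The parameter is to be `s * (n + 1) + b` with `b ≤ n`, for the threshold `s` and the batch size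
`b`. -/
def batchSize : ℕ := c.2.1 % (size c + 1)

def threshold : ℕ := c.2.1 / (size c + 1)

def batchList (j : ℕ) : List Bits :=
  ((List.range (size c)).filter fun x => decide (c.2.2.1.idxOf x / batchSize c = j)).map
    fun x => c.1.1.getD x []

/-- The parameters after `j` gradient steps. -/
def trajectory : ℕ → List ℚ
  | 0 => c.2.2.2
  | j + 1 => stepList S (c.1.2.1, batchList c j, trajectory j)

/-- Whether the model after the batch of position `k` is correct on the element at position `l`. -/
def hit (k l : ℕ) : ℕ :=
  (classify S (c.1.2.1, trajectory S c (k / batchSize c + 1),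
    c.1.1.getD (c.2.2.1.getD l 0) [])).toNat

/-- The difference of `gain` and `baseline` is n! times the advantage: the factor clears the
denominators k + 1 ≤ n, so that the test compares natural numbers. -/
def gain : ℕ := ∑ k ∈ Finset.range (size c), (size c).factorial * hit S c k k

def baseline : ℕ := ∑ k ∈ Finset.range (size c),
  (size c).factorial / (k + 1) * ∑ l ∈ Finset.range (k + 1), hit S c k l

/-- A list of length n that misses none of the numbers below n is a permutation of them. -/
def missing : ℕ := ∑ x ∈ Finset.range (size c), (!decide (c.2.2.1.idxOf x < size c)).toNat

def outside : ℕ := ∑ j ∈ Finset.range (size c / batchSize c),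
  ∑ i ∈ Finset.range (trajectory S c j).length,
    (!decide ((S.numbers c.1.2.1).idxOf ((trajectory S c j).getD i 0) <
      (S.numbers c.1.2.1).length)).toNat

/-- Simplicity of the models is not a decidable property and is not tested. What enters is its
consequence, a large advantage, together with representability, which makes the epoch reversible. -/
def valid : Bool :=
  decide (c.2.2.1.length = size c) && (decide (missing c = 0) && (decide (outside S c = 0) &&
    (decide (trajectory S c (size c / batchSize c) = c.1.2.2.1) &&
      !decide (gain S c < baseline S c + threshold c * (size c).factorial))))

theorem size_primrec : Primrec size :=
  Primrec.list_length.comp (Primrec.fst.comp Primrec.fst)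

theorem batchSize_primrec : Primrec batchSize :=
  Primrec.nat_mod.comp (Primrec.fst.comp Primrec.snd) (Primrec.succ.comp size_primrec)

theorem threshold_primrec : Primrec threshold :=
  Primrec.nat_div.comp (Primrec.fst.comp Primrec.snd) (Primrec.succ.comp size_primrec)

theorem perm_primrec : Primrec fun c : Candidate => c.2.2.1 :=
  Primrec.fst.comp (Primrec.snd.comp Primrec.snd)

theorem data_primrec : Primrec fun c : Candidate => c.1.1 := Primrec.fst.comp Primrec.fst

theorem arch_primrec : Primrec fun c : Candidate => c.1.2.1 :=
  Primrec.fst.comp (Primrec.snd.comp Primrec.fst)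

theorem final_primrec : Primrec fun c : Candidate => c.1.2.2.1 :=
  Primrec.fst.comp (Primrec.snd.comp (Primrec.snd.comp Primrec.fst))

theorem batchList_primrec : Primrec₂ batchList := by
  unfold batchList
  have hrel : PrimrecRel fun (x : ℕ) (q : Candidate × ℕ) =>
      q.1.2.2.1.idxOf x / batchSize q.1 = q.2 := by
    have hc : Primrec fun w : ℕ × Candidate × ℕ => w.2.1 := Primrec.fst.comp Primrec.snd
    exact Primrec.eq.comp (Primrec.nat_div.comp (Primrec.list_idxOf.comp Primrec.fst
      (perm_primrec.comp hc)) (batchSize_primrec.comp hc)) (Primrec.snd.comp Primrec.snd)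
  have hr : Primrec fun q : Candidate × ℕ => List.range (size q.1) :=
    Primrec.list_range.comp (size_primrec.comp Primrec.fst)
  have hf : Primrec fun q : Candidate × ℕ =>
      (List.range (size q.1)).filter fun x => decide (q.1.2.2.1.idxOf x / batchSize q.1 = q.2) :=
    hrel.listFilter.comp hr Primrec.id
  refine Primrec.list_map hf ?_
  exact (Primrec.list_getD []).comp (data_primrec.comp (Primrec.fst.comp Primrec.fst)) Primrec.snd

theorem trajectory_computable : Computable₂ (trajectory S) := by
  have h := Computable.nat_rec (α := Candidate × ℕ) (f := fun q => q.2) (g := fun q => q.1.2.2.2)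
    (h := fun q r => stepList S (q.1.1.2.1, batchList q.1 r.1, r.2))
    Computable.snd ((Computable.snd.comp (Computable.snd.comp Computable.snd)).comp Computable.fst)
    (by
      have hc : Computable fun w : (Candidate × ℕ) × ℕ × List ℚ => w.1.1 :=
        Computable.fst.comp Computable.fst
      have hj : Computable fun w : (Candidate × ℕ) × ℕ × List ℚ => w.2.1 :=
        Computable.fst.comp Computable.snd
      have hW : Computable fun w : (Candidate × ℕ) × ℕ × List ℚ => w.2.2 :=
        Computable.snd.comp Computable.snd
      exact (stepList_computable S).comp (Computable.pair (arch_primrec.to_comp.comp hc)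
        (Computable.pair (batchList_primrec.to_comp.comp hc hj) hW)))
  refine h.of_eq fun q => ?_
  obtain ⟨c, j⟩ := q
  induction j with
  | zero => rfl
  | succ j ih =>
    show _ = trajectory S c (j + 1)
    rw [trajectory, ← ih]

theorem trajectory_zero : trajectory S c 0 = c.2.2.2 := rfl

theorem trajectory_succ (j : ℕ) :
    trajectory S c (j + 1) = stepList S (c.1.2.1, batchList c j, trajectory S c j) := rfl

attribute [irreducible] trajectory

theorem hit_computable : Computable fun q : (Candidate × ℕ) × ℕ => hit S q.1.1 q.1.2 q.2 := by
  have hc : Computable fun w : (Candidate × ℕ) × ℕ => w.1.1 := Computable.fst.comp Computable.fst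
  have hk : Computable fun w : (Candidate × ℕ) × ℕ => w.1.2 := Computable.snd.comp Computable.fst
  have hl : Computable fun w : (Candidate × ℕ) × ℕ => w.2 := Computable.snd
  unfold hit
  have hj : Computable fun w : (Candidate × ℕ) × ℕ => w.1.2 / batchSize w.1.1 + 1 :=
    Computable.succ.comp (computable_div.comp hk (batchSize_primrec.to_comp.comp hc))
  have hx : Computable fun w : (Candidate × ℕ) × ℕ => w.1.1.2.2.1.getD w.2 0 :=
    (Primrec.list_getD 0).to_comp.comp (perm_primrec.to_comp.comp hc) hl
  have hd : Computable fun w : (Candidate × ℕ) × ℕ => w.1.1.1.1.getD (w.1.1.2.2.1.getD w.2 0) [] :=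
    (Primrec.list_getD []).to_comp.comp (data_primrec.to_comp.comp hc) hx
  exact computable_toNat.comp ((classify_computable S).comp (Computable.pair
    (arch_primrec.to_comp.comp hc) (Computable.pair ((trajectory_computable S).comp hc hj) hd)))

theorem gain_computable : Computable (gain S) := by
  unfold gain
  refine computable_sum ?_ size_primrec.to_comp
  have h := (hit_computable S).comp ((Computable.pair Computable.id Computable.snd :
      Computable fun q : Candidate × ℕ => (q, q.2)))
  have hf : Computable fun q : Candidate × ℕ => (size q.1).factorial :=
    computable_factorial.comp (size_primrec.to_comp.comp Computable.fst)
  exact computable_mul.comp hf h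

theorem baseline_computable : Computable (baseline S) := by
  unfold baseline
  refine computable_sum ?_ size_primrec.to_comp
  have hk : Computable fun q : Candidate × ℕ => q.2 + 1 := Computable.succ.comp Computable.snd
  have h : Computable fun q : Candidate × ℕ => ∑ l ∈ Finset.range (q.2 + 1), hit S q.1 q.2 l :=
    computable_sum (hit_computable S) hk
  have hf : Computable fun q : Candidate × ℕ => (size q.1).factorial :=
    computable_factorial.comp (size_primrec.to_comp.comp Computable.fst)
  exact computable_mul.comp (computable_div.comp hf hk) h

theorem missing_computable : Computable missing := by
  unfold missing
  refine computable_sum ?_ size_primrec.to_comp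
  have h : Computable fun q : Candidate × ℕ => q.1.2.2.1.idxOf q.2 :=
    Primrec.list_idxOf.to_comp.comp Computable.snd (perm_primrec.to_comp.comp Computable.fst)
  exact computable_toNat.comp (computable_not.comp (computable_decide_lt.comp h
    (size_primrec.to_comp.comp Computable.fst)))

theorem outside_computable : Computable (outside S) := by
  unfold outside
  have hN : Computable fun c : Candidate => size c / batchSize c :=
    computable_div.comp size_primrec.to_comp batchSize_primrec.to_comp
  refine computable_sum ?_ hN
  have hl : Computable fun q : Candidate × ℕ => (trajectory S q.1 q.2).length :=
    Computable.list_length.comp (trajectory_computable S)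
  refine computable_sum ?_ hl
  have hF : Computable fun q : (Candidate × ℕ) × ℕ => S.numbers q.1.1.1.2.1 :=
    S.computable_numbers.comp (arch_primrec.to_comp.comp (Computable.fst.comp Computable.fst))
  have ht : Computable fun q : (Candidate × ℕ) × ℕ => trajectory S q.1.1 q.1.2 :=
    (trajectory_computable S).comp (Computable.fst.comp Computable.fst)
      (Computable.snd.comp Computable.fst)
  have hi : Computable fun q : (Candidate × ℕ) × ℕ => (trajectory S q.1.1 q.1.2).getD q.2 0 :=
    (Primrec.list_getD 0).to_comp.comp ht Computable.snd
  have hx : Computable fun q : (Candidate × ℕ) × ℕ =>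
      (S.numbers q.1.1.1.2.1).idxOf ((trajectory S q.1.1 q.1.2).getD q.2 0) :=
    Primrec.list_idxOf.to_comp.comp hi hF
  exact computable_toNat.comp (computable_not.comp (computable_decide_lt.comp hx
    (Computable.list_length.comp hF)))

theorem valid_computable : Computable (valid S) := by
  unfold valid
  have hn := size_primrec.to_comp
  have hN : Computable fun c : Candidate => size c / batchSize c :=
    computable_div.comp hn batchSize_primrec.to_comp
  have h1 : Computable fun c : Candidate => decide (c.2.2.1.length = size c) :=
    computable_decide_eq.comp (Computable.list_length.comp perm_primrec.to_comp) hn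
  have h2 : Computable fun c : Candidate => decide (missing c = 0) :=
    computable_decide_eq.comp missing_computable (Computable.const 0)
  have h3 : Computable fun c : Candidate => decide (outside S c = 0) :=
    computable_decide_eq.comp (outside_computable S) (Computable.const 0)
  have hW : Computable fun c : Candidate => trajectory S c (size c / batchSize c) :=
    (trajectory_computable S).comp Computable.id hN
  have heq : Computable₂ fun a b : List ℚ => decide (a = b) := Primrec.eq.decide.to_comp
  have h4 : Computable fun c : Candidate =>
      decide (trajectory S c (size c / batchSize c) = c.1.2.2.1) :=
    heq.comp hW final_primrec.to_comp
  have hb : Computable fun c : Candidate => baseline S c + threshold c * (size c).factorial :=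
    computable_add.comp (baseline_computable S)
      (computable_mul.comp threshold_primrec.to_comp (computable_factorial.comp hn))
  exact computable_and.comp h1 (computable_and.comp h2 (computable_and.comp h3
    (computable_and.comp h4 (computable_not.comp
      (computable_decide_lt.comp (gain_computable S) hb)))))

end Candidate

end SGD

/-! ### Exposing a permutation forwards and backwards. -/

namespace SGD

open Finset Real

section FinExposure

variable {n : ℕ}

theorem card_perm_real : (Fintype.card (Fin n ≃ Fin n) : ℝ) = n.factorial := by
  have : Fintype.card (Fin n ≃ Fin n) = n.factorial := by
    simpa using Fintype.card_perm (α := Fin n)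
  rw [this]

theorem card_forward_increment_le (hn : 0 < n) {p : Equiv.Perm (Fin n) → Fin n → Fin n → ℝ}
    (hp : ∀ (σ : Equiv.Perm (Fin n)) (k a c : Fin n), k ≤ a → k ≤ c →
      p ((Equiv.swap a c).trans σ) k = p σ k)
    (h01 : ∀ σ k x, p σ k x ∈ Set.Icc (0 : ℝ) 1) {x : ℝ} (hx : 0 ≤ x)
    (A : Finset (Equiv.Perm (Fin n)))
    (hA : ∀ σ ∈ A, x ≤ ∑ k : Fin n,
      (p σ k (σ k) - (∑ l with k ≤ l, p σ k (σ l)) / (n - (k : ℕ)))) :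
    (#A : ℝ) ≤ n.factorial * exp (-(2 * x ^ 2 / n)) := by
  rw [← card_perm_real]
  refine card_increment_ge_le (ι := Fin n) (α := Fin n) (p := p) hp h01 (fun _ => 1)
    (by exact_mod_cast hn) hx (by simp) A fun σ hσ => (hA σ hσ).trans_eq ?_
  refine Finset.sum_congr rfl fun k _ => ?_
  have h2 : (#{l : Fin n | k ≤ l} : ℝ) = n - (k : ℕ) := by
    have : Finset.filter (fun l => k ≤ l) Finset.univ = Finset.Ici k := by ext; simp
    rw [this, Fin.card_Ici, Nat.cast_sub k.2.le]
  rw [increment, h2, one_mul]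

/-- Reversal of the positions turns a function determined by the later positions into one determined
by the earlier ones. -/
theorem card_backward_increment_le (hn : 0 < n) {p : Equiv.Perm (Fin n) → Fin n → Fin n → ℝ}
    (hp : ∀ (σ : Equiv.Perm (Fin n)) (k a c : Fin n), a ≤ k → c ≤ k →
      p ((Equiv.swap a c).trans σ) k = p σ k)
    (h01 : ∀ σ k x, p σ k x ∈ Set.Icc (0 : ℝ) 1) {x : ℝ} (hx : 0 ≤ x)
    (A : Finset (Equiv.Perm (Fin n)))
    (hA : ∀ σ ∈ A, x ≤ ∑ k : Fin n,
      (p σ k (σ k) - (∑ l with l ≤ k, p σ k (σ l)) / ((k : ℕ) + 1))) :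
    (#A : ℝ) ≤ n.factorial * exp (-(2 * x ^ 2 / n)) := by
  rw [← card_perm_real, ← Finset.card_map (Equiv.mulRight Fin.revPerm).toEmbedding]
  set q : Equiv.Perm (Fin n) → Fin n → Fin n → ℝ :=
    fun σ k => p (σ * Fin.revPerm) (Fin.rev k) with hq
  have hrev : ∀ σ : Equiv.Perm (Fin n), σ * Fin.revPerm * Fin.revPerm = σ := by
    intro σ; ext k; simp
  rw [card_perm_real]
  refine card_forward_increment_le hn (p := q) ?_ (fun σ k x => h01 _ _ _) hx _ ?_
  · intro σ k a c ha hc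
    simp only [hq]
    rw [← hp (σ * Fin.revPerm) (Fin.rev k) (Fin.rev a) (Fin.rev c) (Fin.rev_le_rev.2 ha)
      (Fin.rev_le_rev.2 hc)]
    congr 1
    ext x
    have : Equiv.swap a c (Fin.rev x) = Fin.rev (Equiv.swap (Fin.rev a) (Fin.rev c) x) := by
      rw [← Fin.rev_injective.swap_apply, Fin.rev_rev, Fin.rev_rev]
    simp [this]
  · intro τ hτ
    obtain ⟨σ, hσ, rfl⟩ := Finset.mem_map.1 hτ
    refine (hA σ hσ).trans_eq ?_
    rw [← Equiv.sum_comp Fin.revPerm]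
    refine Finset.sum_congr rfl fun k _ => ?_
    simp only [hq, Equiv.coe_toEmbedding, Equiv.coe_mulRight, hrev, Fin.revPerm_apply,
      Equiv.Perm.coe_mul, Function.comp_apply]
    have hd : (((Fin.rev k : Fin n) : ℕ) : ℝ) + 1 = n - (k : ℕ) := by
      rw [Fin.val_rev, Nat.cast_sub (by omega)]; push_cast; ring
    rw [hd]
    congr 2
    refine Finset.sum_equiv Fin.revPerm (fun l => ?_) (fun l _ => by simp)
    simp [Fin.le_rev_iff]

end FinExposure

end SGD

/-! ### Dependence of the models on the order, and running an epoch backwards. -/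

namespace SGD

open Finset Real

section Trajectories

variable (S : Software) {n d t : ℕ} (arch : Bits) (X : Fin n → Bits)

/-- `1` if the model classifies the element correctly, and `0` otherwise. -/
noncomputable def score (W : Fin d → ℚ) (x : Fin n) : ℝ := if accFun S arch X W x then 1 else 0

theorem score_mem (W : Fin d → ℚ) (x : Fin n) : score S arch X W x ∈ Set.Icc (0 : ℝ) 1 := by
  unfold score; split_ifs <;> simp

theorem mem_batch {b : ℕ} {σ : Equiv.Perm (Fin n)} {j : ℕ} {x : Fin n} :
    x ∈ batch b σ j ↔ (σ.symm x : ℕ) / b = j := by simp [batch]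

theorem batch_swap {b : ℕ} (σ : Equiv.Perm (Fin n)) {j : ℕ} {a c : Fin n} (ha : (a : ℕ) / b ≠ j)
    (hc : (c : ℕ) / b ≠ j) : batch b ((Equiv.swap a c).trans σ) j = batch b σ j := by
  ext x
  rw [mem_batch, mem_batch]
  simp only [Equiv.symm_trans_apply, Equiv.symm_swap]
  rw [Equiv.swap_apply_def]
  split_ifs with h1 h2
  · rw [h1]; simp [ha, hc]
  · rw [h2]; simp [ha, hc]
  · rfl

theorem batch_nonempty {b : ℕ} (hb : 0 < b) (σ : Equiv.Perm (Fin n)) {j : ℕ} (hj : j < n / b) :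
    (batch b σ j).Nonempty := by
  have h : j * b < n := by
    calc j * b < n / b * b := Nat.mul_lt_mul_of_pos_right hj hb
      _ ≤ n := Nat.div_mul_le_self n b
  exact ⟨σ ⟨j * b, h⟩, mem_batch.2 (by simp [Nat.mul_div_cancel _ hb])⟩

/-- Predictability for the forward exposure: the model before a batch does not depend on how this
batch and the later ones are filled. -/
theorem afterBatches_swap {b : ℕ} (σ : Equiv.Perm (Fin n)) (W : Fin d → ℚ) {a c : Fin n} {j : ℕ}
    (ha : j ≤ (a : ℕ) / b) (hc : j ≤ (c : ℕ) / b) :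
    afterBatches S arch X b ((Equiv.swap a c).trans σ) W j = afterBatches S arch X b σ W j := by
  induction j with
  | zero => rfl
  | succ j ih =>
    rw [afterBatches, afterBatches, ih (by omega) (by omega), batch_swap σ (by omega) (by omega)]

variable {S arch X}

theorem toReal_injective : Function.Injective (toReal (d := d)) := by
  intro W W' h
  funext k
  have := congrArg (fun v : EuclideanSpace ℝ (Fin d) => v k) h
  simpa [toReal] using this

/-- Gradient steps of small size are injective on the machine numbers. -/
theorem gradStep_injective {L : ℝ} (hα : 0 < S.rate arch) (hL : (S.rate arch : ℝ) * L < 1)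
    (hS : IsSmooth S arch X d L) {B : Finset (Fin n)} (hB : B.Nonempty) {W W' : Fin d → ℚ}
    (hW : IsRepresentable S arch W) (hW' : IsRepresentable S arch W')
    (h : gradStep S arch X B W = gradStep S arch X B W') : W = W' := by
  have hα' : (0 : ℝ) < S.rate arch := by exact_mod_cast hα
  have h1 : toReal W - toReal W' =
      (S.rate arch : ℝ) • (toReal (gradOn S arch X B W) - toReal (gradOn S arch X B W')) := by
    ext k
    have h2 := congrFun h k
    unfold gradStep at h2
    have h3 : W k - W' k =
        S.rate arch * (gradOn S arch X B W k - gradOn S arch X B W' k) := by linarith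
    simp only [toReal, PiLp.sub_apply, PiLp.smul_apply, smul_eq_mul]
    exact_mod_cast h3
  have h2 := hS B hB W W' hW hW'
  have h3 : ‖toReal W - toReal W'‖ ≤ S.rate arch * L * ‖toReal W - toReal W'‖ := by
    conv_lhs => rw [h1, norm_smul, Real.norm_of_nonneg hα'.le]
    rw [mul_assoc]
    exact mul_le_mul_of_nonneg_left h2 hα'.le
  have h4 : ‖toReal W - toReal W'‖ = 0 := by
    have := norm_nonneg (toReal W - toReal W')
    nlinarith
  exact toReal_injective (sub_eq_zero.1 (norm_eq_zero.1 h4))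

variable (S arch X)

open Classical in
/-- A model from which the gradient step on the batch `B` leads to `W`. -/
noncomputable def previous (B : Finset (Fin n)) (W : Fin d → ℚ) : Fin d → ℚ :=
  if h : ∃ V, IsRepresentable S arch V ∧ gradStep S arch X B V = W then h.choose else 0

/-- The model before the last `m` of the first `N` batches, when the model after them is `W`. -/
noncomputable def backtrack (b : ℕ) (σ : Equiv.Perm (Fin n)) (N : ℕ) (W : Fin d → ℚ) :
    ℕ → Fin d → ℚ
  | 0 => W
  | m + 1 => previous S arch X (batch b σ (N - (m + 1))) (backtrack b σ N W m)

/-- Predictability for the backward exposure: when the final model is held fixed, the models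
recovered from it are functions of the later batches only. -/
theorem backtrack_swap {b : ℕ} (σ : Equiv.Perm (Fin n)) {N : ℕ} (W : Fin d → ℚ) {a c : Fin n}
    {m : ℕ} (ha : (a : ℕ) / b < N - m) (hc : (c : ℕ) / b < N - m) :
    backtrack S arch X b ((Equiv.swap a c).trans σ) N W m = backtrack S arch X b σ N W m := by
  induction m with
  | zero => rfl
  | succ m ih =>
    rw [backtrack, backtrack, ih (by omega) (by omega), batch_swap σ (by omega) (by omega)]

variable {S arch X}

theorem previous_gradStep {L : ℝ} (hα : 0 < S.rate arch) (hL : (S.rate arch : ℝ) * L < 1)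
    (hS : IsSmooth S arch X d L) {B : Finset (Fin n)} (hB : B.Nonempty) {W : Fin d → ℚ}
    (hW : IsRepresentable S arch W) : previous S arch X B (gradStep S arch X B W) = W := by
  have h : ∃ V, IsRepresentable S arch V ∧ gradStep S arch X B V = gradStep S arch X B W :=
    ⟨W, hW, rfl⟩
  rw [previous, dif_pos h]
  exact gradStep_injective hα hL hS hB h.choose_spec.1 hW h.choose_spec.2

/-- Each step back is unambiguous by injectivity. Only the models before the steps have to be
representable; the final model need not be. -/
theorem backtrack_eq_afterBatches {L : ℝ} (hα : 0 < S.rate arch)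
    (hL : (S.rate arch : ℝ) * L < 1) (hS : IsSmooth S arch X d L) {b : ℕ} (hb : 0 < b)
    (σ : Equiv.Perm (Fin n)) (W : Fin d → ℚ)
    (hW : ∀ j < n / b, IsRepresentable S arch (afterBatches S arch X b σ W j)) {m : ℕ}
    (hm : m ≤ n / b) :
    backtrack S arch X b σ (n / b) (afterBatches S arch X b σ W (n / b)) m =
      afterBatches S arch X b σ W (n / b - m) := by
  induction m with
  | zero => rfl
  | succ m ih =>
    rw [backtrack, ih (by omega)]
    have h : n / b - m = n / b - (m + 1) + 1 := by omega
    rw [h, afterBatches]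
    exact previous_gradStep hα hL hS (batch_nonempty hb σ (by omega)) (hW _ (by omega))

/-- The advantage of the models after the batches on their batches, over the previous elements. -/
noncomputable def advantage (S : Software) (arch : Bits) (X : Fin n → Bits) (b : ℕ)
    (σ : Equiv.Perm (Fin n)) (f : ℕ → Fin d → ℚ) : ℝ :=
  ∑ k : Fin n, (score S arch X (f ((k : ℕ) / b + 1)) (σ k) -
    (∑ l with l ≤ k, score S arch X (f ((k : ℕ) / b + 1)) (σ l)) / ((k : ℕ) + 1))

/-- The final model `W` is fixed before σ varies. The model after the batch of position `k` is then
recovered from later batches, so the terms of the advantage are the increments of the backward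
exposure. -/
theorem card_advantage_backtrack_le {b : ℕ} (hbn : b ∣ n) (hn : 0 < n)
    (W : Fin d → ℚ) {x : ℝ} (hx : 0 ≤ x) (A : Finset (Equiv.Perm (Fin n)))
    (hA : ∀ σ ∈ A, x ≤ advantage S arch X b σ
      (fun j => backtrack S arch X b σ (n / b) W (n / b - j))) :
    (#A : ℝ) ≤ n.factorial * exp (-(2 * x ^ 2 / n)) := by
  refine card_backward_increment_le hn (p := fun σ k =>
    score S arch X (backtrack S arch X b σ (n / b) W (n / b - ((k : ℕ) / b + 1)))) ?_
    (fun σ k x => score_mem _ _ _ _ _) hx A hA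
  intro σ k a c ha hc
  have hk : (k : ℕ) / b < n / b := Nat.div_lt_div_of_lt_of_dvd hbn k.2
  have ha' : (a : ℕ) / b ≤ (k : ℕ) / b := Nat.div_le_div_right ha
  have hc' : (c : ℕ) / b ≤ (k : ℕ) / b := Nat.div_le_div_right hc
  rw [backtrack_swap S arch X σ W (by omega) (by omega)]

/-- It is unlikely that the models are much worse on the next batches than on all the elements
to come. -/
theorem card_forward_loss_le {b : ℕ} (hn : 0 < n) (W : Fin d → ℚ) {x : ℝ} (hx : 0 ≤ x)
    (A : Finset (Equiv.Perm (Fin n)))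
    (hA : ∀ σ ∈ A, x ≤ ∑ k : Fin n, ((∑ l with k ≤ l,
      score S arch X (afterBatches S arch X b σ W ((k : ℕ) / b)) (σ l)) / (n - (k : ℕ)) -
        score S arch X (afterBatches S arch X b σ W ((k : ℕ) / b)) (σ k))) :
    (#A : ℝ) ≤ n.factorial * exp (-(2 * x ^ 2 / n)) := by
  -- Incorrectness, 1 minus the score, turns a loss on the next element into a positive increment.
  refine card_forward_increment_le hn (p := fun σ k x =>
    1 - score S arch X (afterBatches S arch X b σ W ((k : ℕ) / b)) x) ?_
    (fun σ k x => ?_) hx A fun σ hσ => (hA σ hσ).trans_eq ?_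
  · intro σ k a c ha hc
    rw [afterBatches_swap S arch X σ W (Nat.div_le_div_right ha) (Nat.div_le_div_right hc)]
  · have := score_mem S arch X (afterBatches S arch X b σ W ((k : ℕ) / b)) x
    exact ⟨by linarith [this.2], by linarith [this.1]⟩
  · refine Finset.sum_congr rfl fun k _ => ?_
    have h2 : (#{l : Fin n | k ≤ l} : ℝ) = n - (k : ℕ) := by
      have : Finset.filter (fun l => k ≤ l) Finset.univ = Finset.Ici k := by ext; simp
      rw [this, Fin.card_Ici, Nat.cast_sub k.2.le]
    have h3 : (n : ℝ) - (k : ℕ) ≠ 0 := by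
      have : ((k : ℕ) : ℝ) < n := by exact_mod_cast k.2
      intro h; linarith
    rw [Finset.sum_sub_distrib, Finset.sum_const, nsmul_eq_mul, mul_one, h2, sub_div, div_self h3]
    ring

end Trajectories

end SGD

/-! ### Permutations, batches and gradient steps as lists. -/

namespace SGD

open Finset Real

section Lists

variable {n : ℕ}

/-- A permutation as the list of its values. -/
def permList (σ : Equiv.Perm (Fin n)) : List ℕ := List.ofFn fun k => (σ k : ℕ)

theorem permList_length (σ : Equiv.Perm (Fin n)) : (permList σ).length = n := by simp [permList]

theorem permList_getD (σ : Equiv.Perm (Fin n)) (k : Fin n) : (permList σ).getD k 0 = σ k := by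
  simp [permList, List.getD_eq_getElem?_getD]

theorem idxOf_permList (σ : Equiv.Perm (Fin n)) (x : Fin n) :
    (permList σ).idxOf (x : ℕ) = σ.symm x := by
  have hnd : (permList σ).Nodup := by
    rw [permList, List.nodup_ofFn]
    exact Fin.val_injective.comp σ.injective
  have h := hnd.idxOf_getElem (σ.symm x : ℕ) (by rw [permList_length]; exact (σ.symm x).2)
  rwa [show (permList σ)[((σ.symm x : Fin n) : ℕ)]'(by
    rw [permList_length]; exact (σ.symm x).2) = (x : ℕ) by simp [permList]] at h

theorem exists_eq_permList {l : List ℕ} (hl : l.length = n) (h : ∀ x < n, l.idxOf x < n) :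
    ∃ σ : Equiv.Perm (Fin n), l = permList σ := by
  set τ : Fin n → Fin n := fun x => ⟨l.idxOf (x : ℕ), h x x.2⟩ with hτ
  have hget : ∀ x : Fin n, l[l.idxOf (x : ℕ)]'(by rw [hl]; exact h x x.2) = (x : ℕ) :=
    fun x => List.getElem_idxOf _
  have hinj : Function.Injective τ := by
    intro x y hxy
    have h1 : l.idxOf (x : ℕ) = l.idxOf (y : ℕ) := congrArg Fin.val hxy
    have h2 := hget x
    simp only [h1] at h2
    exact Fin.ext (h2.symm.trans (hget y))
  set e := Equiv.ofBijective τ (Finite.injective_iff_bijective.1 hinj) with he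
  refine ⟨e.symm, List.ext_getElem (by rw [hl, permList_length]) fun k hk _ => ?_⟩
  have hk' : k < n := by omega
  have h1 : τ (e.symm ⟨k, hk'⟩) = ⟨k, hk'⟩ := e.apply_symm_apply _
  have h2 : l.idxOf ((e.symm ⟨k, hk'⟩ : Fin n) : ℕ) = k := congrArg Fin.val h1
  have h3 := hget (e.symm ⟨k, hk'⟩)
  simp only [h2] at h3
  rw [h3]
  simp [permList]

theorem sort_filter_univ (p : Fin n → Prop) [DecidablePred p] :
    (Finset.univ.filter p).sort (· ≤ ·) = (List.finRange n).filter fun x => decide (p x) := by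
  refine List.Perm.eq_of_pairwise' (r := (· ≤ ·)) (Finset.pairwise_sort _ _)
    ((List.pairwise_le_finRange n).filter _) ?_
  rw [List.perm_ext_iff_of_nodup (Finset.sort_nodup _ _) ((List.nodup_finRange n).filter _)]
  intro x
  simp

theorem range_eq_map_finRange : List.range n = (List.finRange n).map Fin.val := by
  refine List.ext_getElem (by simp) fun k _ _ => by simp

theorem map_sort_batch (X : Fin n → Bits) (b : ℕ) (σ : Equiv.Perm (Fin n)) (j : ℕ) :
    ((batch b σ j).sort (· ≤ ·)).map X =
      ((List.range n).filter fun x => decide ((permList σ).idxOf x / b = j)).map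
        fun x => (List.ofFn X).getD x [] := by
  rw [batch, sort_filter_univ, range_eq_map_finRange, List.filter_map, List.map_map]
  have h : ((fun x => decide ((permList σ).idxOf x / b = j)) ∘ Fin.val) =
      fun x : Fin n => decide ((σ.symm x : ℕ) / b = j) := by
    funext x; simp [idxOf_permList]
  rw [h]
  refine List.map_congr_left fun x _ => ?_
  simp [List.getD_eq_getElem?_getD]

theorem stepList_ofFn {d : ℕ} (S : Software) (a : Bits) (B : List Bits) (W : Fin d → ℚ) :
    stepList S (a, B, List.ofFn W) =
      List.ofFn fun k => W k - S.rate a * S.grad a B d W k := by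
  -- The program reads the dimension off the list. Comparing pairs of a dimension and a vector
  -- avoids a transport along `(List.ofFn W).length = d`.
  have h : (⟨(List.ofFn W).length, (List.ofFn W).get⟩ : Σ m, Fin m → ℚ) = ⟨d, W⟩ :=
    List.equivSigmaTuple.apply_symm_apply ⟨d, W⟩
  exact congrArg (fun p : Σ m, Fin m → ℚ =>
    List.ofFn fun k => p.2 k - S.rate a * S.grad a B p.1 p.2 k) h

end Lists

/-! ### Correctness of the test and the number of valid candidates. -/

section Decoder

variable (S : Software) {n d : ℕ} (arch : Bits) (X : Fin n → Bits)

/-- The condition of the complexity of a permutation: the dataset and a model. -/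
def condition (W : Fin d → ℚ) (e : ℕ) : List Bits × ModelCode :=
  (List.ofFn X, (arch, List.ofFn W, e, 0))

variable (W V : Fin d → ℚ) (e m b s : ℕ) (σ : Equiv.Perm (Fin n))

def candidate : Candidate := (condition arch X W e, m, permList σ, List.ofFn V)

theorem candidate_size : (candidate arch X W V e m σ).size = n := by
  simp [candidate, Candidate.size, condition]

variable {m b s}

theorem candidate_batchSize (hb : b ≤ n) (hm : m = s * (n + 1) + b) :
    (candidate arch X W V e m σ).batchSize = b := by
  rw [Candidate.batchSize, candidate_size, show (candidate arch X W V e m σ).2.1 = m from rfl, hm,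
    Nat.mul_add_mod_self_right, Nat.mod_eq_of_lt (by omega)]

theorem candidate_threshold (hb : b ≤ n) (hm : m = s * (n + 1) + b) :
    (candidate arch X W V e m σ).threshold = s := by
  rw [Candidate.threshold, candidate_size, show (candidate arch X W V e m σ).2.1 = m from rfl, hm,
    add_comm, Nat.add_mul_div_right _ _ (by omega), Nat.div_eq_of_lt (by omega), zero_add]

theorem candidate_trajectory (hb : b ≤ n) (hm : m = s * (n + 1) + b) (j : ℕ) :
    (candidate arch X W V e m σ).trajectory S j = List.ofFn (afterBatches S arch X b σ V j) := by
  induction j with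
  | zero => rw [Candidate.trajectory_zero]; rfl
  | succ j ih =>
    have hB : (candidate arch X W V e m σ).batchList j =
        ((batch b σ j).sort (· ≤ ·)).map X := by
      rw [map_sort_batch, Candidate.batchList, candidate_size, candidate_batchSize (s := s) arch X W V e σ hb hm]
      rfl
    rw [Candidate.trajectory_succ, ih, hB]
    exact stepList_ofFn S _ _ _

theorem candidate_hit (hb : b ≤ n) (hm : m = s * (n + 1) + b) (k l : Fin n) :
    ((candidate arch X W V e m σ).hit S k l : ℝ) =
      score S arch X (afterBatches S arch X b σ V ((k : ℕ) / b + 1)) (σ l) := by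
  have h1 : (candidate arch X W V e m σ).2.2.1.getD (l : ℕ) 0 = σ l := permList_getD σ l
  have h2 : (candidate arch X W V e m σ).1.1.getD ((σ l : Fin n) : ℕ) [] = X (σ l) := by
    simp [candidate, condition, List.getD_eq_getElem?_getD]
  rw [Candidate.hit, candidate_batchSize (s := s) arch X W V e σ hb hm,
    candidate_trajectory S arch X W V e σ hb hm, h1, h2]
  simp only [classify, score, accFun]
  rw [show (candidate arch X W V e m σ).1.2.1 = arch from rfl]
  split_ifs with h <;> simp [h]

theorem candidate_missing : (candidate arch X W V e m σ).missing = 0 := by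
  rw [Candidate.missing, Finset.sum_eq_zero_iff, candidate_size]
  intro x hx
  have hx' : x < n := by simpa using hx
  have : (candidate arch X W V e m σ).2.2.1.idxOf x < n := by
    have := idxOf_permList σ ⟨x, hx'⟩
    rw [show (candidate arch X W V e m σ).2.2.1 = permList σ from rfl, this]
    exact (σ.symm _).2
  simp [this]

theorem candidate_outside (hb : b ≤ n) (hm : m = s * (n + 1) + b) :
    (candidate arch X W V e m σ).outside S = 0 ↔
      ∀ j < n / b, IsRepresentable S arch (afterBatches S arch X b σ V j) := by
  rw [Candidate.outside, Finset.sum_eq_zero_iff, candidate_size,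
    candidate_batchSize (s := s) arch X W V e σ hb hm]
  simp only [Finset.mem_range, Finset.sum_eq_zero_iff]
  refine forall_congr' fun j => imp_congr_right fun hj => ?_
  rw [candidate_trajectory S arch X W V e σ hb hm, List.length_ofFn,
    show (candidate arch X W V e m σ).1.2.1 = arch from rfl]
  constructor
  · intro h k
    have := h k k.2
    simpa [List.getD_eq_getElem?_getD, List.idxOf_lt_length_iff] using this
  · intro h k hk
    have := h ⟨k, hk⟩
    simpa [List.getD_eq_getElem?_getD, List.idxOf_lt_length_iff, hk] using this

theorem candidate_gain (hb : b ≤ n) (hm : m = s * (n + 1) + b) :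
    ((candidate arch X W V e m σ).gain S : ℝ) - (candidate arch X W V e m σ).baseline S =
      n.factorial * advantage S arch X b σ (afterBatches S arch X b σ V) := by
  rw [Candidate.gain, Candidate.baseline, candidate_size, advantage, Finset.mul_sum]
  push_cast
  rw [← Finset.sum_sub_distrib, ← Fin.sum_univ_eq_sum_range (fun k =>
    (n.factorial : ℝ) * ((candidate arch X W V e m σ).hit S k k : ℝ) -
      ((n.factorial / (k + 1) : ℕ) : ℝ) * ∑ l ∈ Finset.range (k + 1),
        ((candidate arch X W V e m σ).hit S k l : ℝ))]
  refine Finset.sum_congr rfl fun k _ => ?_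
  -- The division of natural numbers is exact because k + 1 divides n!.
  have hdiv : ((n.factorial / ((k : ℕ) + 1) : ℕ) : ℝ) = n.factorial / ((k : ℕ) + 1) := by
    rw [Nat.cast_div (Nat.dvd_factorial (by omega) (by omega)) (by positivity)]
    push_cast; rfl
  have hsum : ∑ l ∈ Finset.range ((k : ℕ) + 1), ((candidate arch X W V e m σ).hit S k l : ℝ) =
      ∑ l with l ≤ k, score S arch X (afterBatches S arch X b σ V ((k : ℕ) / b + 1)) (σ l) := by
    rw [← sum_fin_lt_eq_sum_range (n := n) (by omega)]
    refine Finset.sum_congr ?_ fun l _ => candidate_hit S arch X W V e σ hb hm k l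
    refine Finset.filter_congr fun l _ => ?_
    rw [Fin.le_def, Nat.lt_succ_iff]
  rw [hdiv, hsum, candidate_hit S arch X W V e σ hb hm]
  ring

theorem candidate_valid (hb : b ≤ n) (hm : m = s * (n + 1) + b) :
    (candidate arch X W V e m σ).valid S = true ↔
      (∀ j < n / b, IsRepresentable S arch (afterBatches S arch X b σ V j)) ∧
        afterBatches S arch X b σ V (n / b) = W ∧
          (s : ℝ) ≤ advantage S arch X b σ (afterBatches S arch X b σ V) := by
  have h1 : (candidate arch X W V e m σ).2.2.1.length = n := permList_length σ
  have h2 : (candidate arch X W V e m σ).1.2.2.1 = List.ofFn W := rfl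
  have hf : (0 : ℝ) < n.factorial := by exact_mod_cast n.factorial_pos
  have h3 : (candidate arch X W V e m σ).baseline S + s * n.factorial ≤
      (candidate arch X W V e m σ).gain S ↔
        (s : ℝ) ≤ advantage S arch X b σ (afterBatches S arch X b σ V) := by
    have hg := candidate_gain S arch X W V e σ hb hm
    rw [← Nat.cast_le (α := ℝ), ← mul_le_mul_iff_right₀ hf (b := (s : ℝ)), ← hg]
    push_cast
    constructor <;> intro h <;> linarith
  rw [Candidate.valid]
  simp only [Bool.and_eq_true, decide_eq_true_eq, Bool.not_eq_true', decide_eq_false_iff_not,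
    not_lt, candidate_outside S arch X W V e σ hb hm, candidate_size, h1, h2,
    candidate_missing, candidate_batchSize (s := s) arch X W V e σ hb hm,
    candidate_threshold (s := s) arch X W V e σ hb hm,
    candidate_trajectory S arch X W V e σ hb hm, List.ofFn_injective.eq_iff, h3, true_and]

/-- Gradient steps preserve the length of the parameter list, so ending in a model of dimension `d`
forces the initial list to have length `d`. -/
theorem exists_eq_candidate (x : List ℕ × List ℚ)
    (h : Candidate.valid S (condition arch X W e, m, x) = true) :
    ∃ (σ : Equiv.Perm (Fin n)) (V : Fin d → ℚ), x = (permList σ, List.ofFn V) := by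
  set c : Candidate := (condition arch X W e, m, x) with hc
  have hsize : c.size = n := by simp [hc, Candidate.size, condition]
  rw [Candidate.valid] at h
  simp only [Bool.and_eq_true, decide_eq_true_eq] at h
  obtain ⟨h1, h2, -, h4, -⟩ := h
  rw [hsize] at h1
  rw [Candidate.missing, Finset.sum_eq_zero_iff, hsize] at h2
  obtain ⟨σ, hσ⟩ := exists_eq_permList (l := x.1) h1 fun k hk => by
    have := h2 k (by simpa using hk)
    simpa using this
  have hlen : ∀ j, (c.trajectory S j).length = x.2.length := by
    intro j
    induction j with
    | zero => rw [Candidate.trajectory_zero]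
    | succ j ih => rw [Candidate.trajectory_succ, ← ih, stepList, List.length_ofFn]
  have hd : x.2.length = d := by
    rw [← hlen (c.size / c.batchSize), h4]
    simp [hc, condition]
  refine ⟨σ, fun k => x.2[k], Prod.ext hσ ?_⟩
  refine List.ext_getElem (by simp [hd]) fun k _ _ => by simp

/-- A valid candidate is determined by its permutation alone, since running the epoch backwards from
`W` recovers its initial model. So it suffices to count permutations whose backtracked models have
advantage at least `s`. -/
theorem card_valid_le {L : ℝ} (hα : 0 < S.rate arch) (hL : (S.rate arch : ℝ) * L < 1)
    (hS : IsSmooth S arch X d L) (hb0 : 0 < b) (hbn : b ∣ n) (hn : 0 < n)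
    (hm : m = s * (n + 1) + b) (A : Finset (List ℕ × List ℚ))
    (hA : ∀ x ∈ A, Candidate.valid S (condition arch X W e, m, x) = true) :
    (#A : ℝ) ≤ n.factorial * exp (-(2 * (s : ℝ) ^ 2 / n)) := by
  classical
  have hb : b ≤ n := Nat.le_of_dvd hn hbn
  have hex : ∀ x ∈ A, ∃ (σ : Equiv.Perm (Fin n)) (V : Fin d → ℚ), x = (permList σ, List.ofFn V) :=
    fun x hx => exists_eq_candidate S arch X W e x (hA x hx)
  choose! σ V hσV using hex
  have hval : ∀ x ∈ A, (∀ j < n / b, IsRepresentable S arch (afterBatches S arch X b (σ x) (V x) j)) ∧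
      afterBatches S arch X b (σ x) (V x) (n / b) = W ∧
        (s : ℝ) ≤ advantage S arch X b (σ x) (afterBatches S arch X b (σ x) (V x)) := by
    intro x hx
    rw [← candidate_valid S arch X W (V x) e (σ x) hb hm, candidate, ← hσV x hx]
    exact hA x hx
  have hback : ∀ x ∈ A, ∀ j ≤ n / b, backtrack S arch X b (σ x) (n / b) W (n / b - j) =
      afterBatches S arch X b (σ x) (V x) j := by
    intro x hx j hj
    obtain ⟨h1, h2, -⟩ := hval x hx
    have := backtrack_eq_afterBatches hα hL hS hb0 (σ x) (V x) h1 (m := n / b - j) (by omega)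
    rw [h2] at this
    rw [this]
    congr 1
    omega
  have hinj : Set.InjOn σ A := by
    intro x hx y hy hxy
    have h1 := hback x hx 0 (Nat.zero_le _)
    have h2 := hback y hy 0 (Nat.zero_le _)
    rw [hxy, h2] at h1
    have h3 : V y = V x := h1
    rw [hσV x hx, hσV y hy, hxy, h3]
  rw [← Finset.card_image_of_injOn hinj]
  refine card_advantage_backtrack_le (S := S) (arch := arch) (X := X) hbn hn W (by positivity) _ ?_
  intro τ hτ
  obtain ⟨x, hx, rfl⟩ := Finset.mem_image.1 hτ
  refine (hval x hx).2.2.trans_eq ?_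
  unfold advantage
  refine Finset.sum_congr rfl fun k _ => ?_
  have hk : (k : ℕ) / b < n / b := Nat.div_lt_div_of_lt_of_dvd hbn k.2
  beta_reduce
  rw [hback x hx _ (by omega)]

end Decoder

end SGD

/-! ### From the number of candidates to the complexity bound. -/

namespace SGD

open Real

/-- This is n! ≤ e n (n/e)ⁿ. The induction step uses log(1 + 1/n) ≥ 1/(n+1). -/
theorem log_factorial_le {n : ℕ} (hn : 0 < n) :
    log (n.factorial : ℝ) ≤ 1 + log n + n * (log n - 1) := by
  induction n, hn using Nat.le_induction with
  | base => simp
  | succ n hn ih =>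
    have hn' : (0 : ℝ) < n := by exact_mod_cast hn
    have h1 : log ((n + 1).factorial : ℝ) = log (n + 1) + log n.factorial := by
      rw [Nat.factorial_succ, Nat.cast_mul, log_mul (by positivity)
        (by exact_mod_cast n.factorial_pos.ne')]
      push_cast; rfl
    have h2 : 1 - ((n + 1 : ℝ) / n)⁻¹ ≤ log ((n + 1 : ℝ) / n) :=
      one_sub_inv_le_log_of_pos (by positivity)
    rw [log_div (by positivity) hn'.ne'] at h2
    have h3 : 1 - ((n + 1 : ℝ) / n)⁻¹ = 1 / (n + 1) := by field_simp; ring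
    rw [h3, div_le_iff₀ (by positivity)] at h2
    rw [h1]
    push_cast
    nlinarith

section Numerics

theorem one_le_logb_two {n : ℕ} (hn : 2 ≤ n) : 1 ≤ logb 2 (n : ℝ) := by
  have h : (2 : ℝ) ≤ n := by exact_mod_cast hn
  calc (1 : ℝ) = logb 2 2 := (logb_self_eq_one (by norm_num)).symm
    _ ≤ logb 2 n := logb_le_logb_of_le (by norm_num) (by norm_num) h

theorem natLog_le_logb {m : ℕ} (hm : 0 < m) : (Nat.log 2 m : ℝ) ≤ logb 2 m := by
  rw [le_logb_iff_rpow_le (by norm_num) (by exact_mod_cast hm), rpow_natCast]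
  exact_mod_cast Nat.pow_log_le_self 2 hm.ne'

/-- The factor (n+1)² accounts for the parameter of the decoder. The 15 collects 3 from the
factorial, 4 from (n+1)² and 8 from the doubly logarithmic term. -/
theorem natLog_add_natLog_le {n c N : ℕ} {β s : ℝ} (hn : 2 ≤ n) (hβ : 0 < β)
    (hβ1 : β ≤ 1) (hs : n * β / 8 ≤ s) (hN0 : 0 < N)
    (hN : (N : ℝ) ≤ n.factorial * exp (-(2 * s ^ 2 / n))) :
    ((Nat.log 2 (N * (n + 1) ^ 2) +
        2 * Nat.log 2 (Nat.log 2 (N * (n + 1) ^ 2) + 1) + c : ℕ) : ℝ) ≤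
      n * (logb 2 (n / exp 1) - β ^ 3 / 512) + (c + 15 : ℝ) * logb 2 n := by
  have hn0 : (0 : ℝ) < n := by positivity
  have hlogn := one_le_logb_two hn
  have hln2 : 0 < log 2 := log_pos (by norm_num)
  have hln2' : log 2 ≤ 1 := by linarith [log_two_lt_d9]
  have hN0' : (0 : ℝ) < N := by exact_mod_cast hN0
  have hfac : (0 : ℝ) < n.factorial := by exact_mod_cast n.factorial_pos
  -- the main term
  have hx : n * β ^ 3 / 512 ≤ 2 * s ^ 2 / n := by
    rw [le_div_iff₀ hn0]
    have h1 : (n * β / 8) ^ 2 ≤ s ^ 2 := by gcongr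
    have h2 : β ^ 3 ≤ β ^ 2 := by nlinarith [sq_nonneg β]
    have h3 : 0 < (n : ℝ) ^ 2 := by positivity
    nlinarith
  have h1 : log N ≤ 1 + log n + n * (log n - 1) - n * β ^ 3 / 512 := by
    have := log_le_log hN0' hN
    rw [log_mul hfac.ne' (exp_pos _).ne', log_exp] at this
    have := log_factorial_le (n := n) (by omega)
    linarith
  have h2 : logb 2 N ≤ n * (logb 2 (n / exp 1) - β ^ 3 / 512) + 3 * logb 2 n := by
    have e1 : logb 2 (n / exp 1) = (log n - 1) / log 2 := by
      rw [logb, log_div hn0.ne' (exp_pos _).ne', log_exp]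
    have e2 : 1 ≤ 2 * log n := by
      have : log 2 ≤ log n := log_le_log (by norm_num) (by exact_mod_cast hn)
      linarith [log_two_gt_d9]
    have e3 : n * β ^ 3 / 512 * log 2 ≤ n * β ^ 3 / 512 :=
      mul_le_of_le_one_right (by positivity) hln2'
    rw [e1, logb, logb, div_le_iff₀ hln2]
    have e4 : (n * ((log n - 1) / log 2 - β ^ 3 / 512) + 3 * (log n / log 2)) * log 2 =
        n * (log n - 1) - n * β ^ 3 / 512 * log 2 + 3 * log n := by
      field_simp
    rw [e4]
    linarith
  have h3 : logb 2 ((n : ℝ) + 1) ≤ 2 * logb 2 n := by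
    have : logb 2 ((n : ℝ) ^ 2) = 2 * logb 2 n := by
      rw [← rpow_natCast, logb_rpow_eq_mul_logb_of_pos hn0]; norm_num
    rw [← this]
    refine logb_le_logb_of_le (by norm_num) (by positivity) ?_
    have : (2 : ℝ) ≤ n := by exact_mod_cast hn
    nlinarith
  have h4 : (Nat.log 2 (N * (n + 1) ^ 2) : ℝ) ≤
      n * (logb 2 (n / exp 1) - β ^ 3 / 512) + 7 * logb 2 n := by
    refine (natLog_le_logb (by positivity)).trans ?_
    push_cast
    rw [logb_mul hN0'.ne' (by positivity)]
    have : logb 2 (((n : ℝ) + 1) ^ 2) = 2 * logb 2 ((n : ℝ) + 1) := by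
      rw [← rpow_natCast, logb_rpow_eq_mul_logb_of_pos (by positivity)]; norm_num
    rw [this]
    linarith
  -- the logarithmic term
  have h5 : Nat.log 2 (N * (n + 1) ^ 2) + 1 ≤ n ^ 4 := by
    have hNfac : N ≤ n.factorial := by
      have : (N : ℝ) ≤ n.factorial := by
        refine hN.trans (mul_le_of_le_one_right hfac.le (exp_le_one_iff.2 ?_))
        rw [neg_nonpos]; positivity
      exact_mod_cast this
    have h2n : n + 1 ≤ 2 ^ n := Nat.lt_two_pow_self
    have hle : N * (n + 1) ^ 2 ≤ 2 ^ (n * n + 2 * n) := by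
      calc N * (n + 1) ^ 2 ≤ n ^ n * (n + 1) ^ 2 :=
            Nat.mul_le_mul_right _ (hNfac.trans (Nat.factorial_le_pow n))
        _ ≤ (2 ^ n) ^ n * (2 ^ n) ^ 2 :=
            Nat.mul_le_mul (Nat.pow_le_pow_left (by omega) _) (Nat.pow_le_pow_left h2n _)
        _ = 2 ^ (n * n + 2 * n) := by rw [← pow_mul, ← pow_mul, ← pow_add]; congr 1; ring
    have := Nat.log_mono_right (b := 2) hle
    rw [Nat.log_pow (by norm_num)] at this
    have h6 : (n + 1) ^ 2 ≤ (n ^ 2) ^ 2 := Nat.pow_le_pow_left (by nlinarith) 2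
    nlinarith
  have h6 : (Nat.log 2 (Nat.log 2 (N * (n + 1) ^ 2) + 1) : ℝ) ≤ 4 * logb 2 n := by
    refine (natLog_le_logb (by omega)).trans ?_
    have : logb 2 ((n : ℝ) ^ 4) = 4 * logb 2 n := by
      rw [← rpow_natCast, logb_rpow_eq_mul_logb_of_pos hn0]; norm_num
    rw [← this]
    refine logb_le_logb_of_le (by norm_num) (by positivity) ?_
    exact_mod_cast h5
  have h7 : (c : ℝ) ≤ c * logb 2 n := le_mul_of_one_le_right (by positivity) hlogn
  push_cast at h4 h6 ⊢
  linarith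

end Numerics

/-- The decoder enumerates valid pairs of a permutation and an initial model, and outputs only the
permutation. The test is one program for all architectures, datasets and parameters, so the constant
depends on `U` and `S` only. -/
theorem condK_permList_le {U : Bits → ℕ →. ℕ} (hU : IsUniversalPrefixMachine U) (S : Software) :
    ∃ C : ℝ, ∀ (n b d s e : ℕ) (arch : Bits) (X : Fin n → Bits) (V : Fin d → ℚ)
      (σ : Equiv.Perm (Fin n)) (L β : ℝ), 0 < S.rate arch → (S.rate arch : ℝ) * L < 1 →
      IsSmooth S arch X d L → 0 < b → b ∣ n → 2 ≤ n → 0 < β → β ≤ 1 → s ≤ n → n * β / 8 ≤ s →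
      (∀ j < n / b, IsRepresentable S arch (afterBatches S arch X b σ V j)) →
      (s : ℝ) ≤ advantage S arch X b σ (afterBatches S arch X b σ V) →
      (condK U (permList σ) (condition arch X (afterBatches S arch X b σ V (n / b)) e) : ℝ) ≤
        n * (logb 2 (n / exp 1) - β ^ 3 / 512) + C * logb 2 n := by
  have hQ : Computable fun y : List Bits × ModelCode => (y.1.length + 1) ^ 2 := by
    have h : Primrec fun y : List Bits × ModelCode => (y.1.length + 1) * (y.1.length + 1) :=
      Primrec.nat_mul.comp (Primrec.succ.comp (Primrec.list_length.comp Primrec.fst))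
        (Primrec.succ.comp (Primrec.list_length.comp Primrec.fst))
    exact h.to_comp.of_eq fun y => (sq _).symm
  obtain ⟨c, hc⟩ := condK_le_log_card hU (Candidate.valid_computable S) hQ
    (Computable.fst : Computable fun x : List ℕ × List ℚ => x.1)
  refine ⟨c + 15, fun n b d s e arch X V σ L β hα hL hS hb0 hbn hn hβ hβ1 hsn hs hrep hadv => ?_⟩
  have hb : b ≤ n := Nat.le_of_dvd (by omega) hbn
  set W := afterBatches S arch X b σ V (n / b) with hW
  set m := s * (n + 1) + b with hm
  set N : ℕ := ⌊n.factorial * exp (-(2 * (s : ℝ) ^ 2 / n))⌋₊ with hN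
  have hpos : 0 ≤ n.factorial * exp (-(2 * (s : ℝ) ^ 2 / n)) := by positivity
  have hcard : ∀ A : Finset (List ℕ × List ℚ),
      (∀ x ∈ A, Candidate.valid S (condition arch X W e, m, x) = true) → A.card ≤ N :=
    fun A hA => Nat.le_floor (card_valid_le S arch X W e hα hL hS hb0 hbn (by omega) hm A hA)
  have hvalid : Candidate.valid S (condition arch X W e, m, (permList σ, List.ofFn V)) = true :=
    (candidate_valid S arch X W V e σ hb hm).2 ⟨hrep, rfl, hadv⟩
  -- The actual epoch is itself a valid candidate.
  have hN0 : 0 < N := hcard {(permList σ, List.ofFn V)} (by simpa using hvalid)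
  have hlen : (condition arch X W e).1.length = n := by simp [condition]
  have hmQ : m < ((condition arch X W e).1.length + 1) ^ 2 := by rw [hlen, hm]; nlinarith
  have h := hc (condition arch X W e) m N _ hmQ hvalid hcard
  rw [hlen] at h
  calc (condK U (permList σ) (condition arch X W e) : ℝ) ≤ _ := Nat.cast_le.2 h
    _ ≤ _ := natLog_add_natLog_le hn hβ hβ1 hs hN0 (Nat.floor_le hpos)

end SGD

/-! ### From local progress to an advantage over the previous elements. -/

namespace SGD

open Finset Real

section Blocks

variable {n b : ℕ}

theorem card_block (hb : 0 < b) {j : ℕ} (hj : j < n / b) :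
    #{k : Fin n | (k : ℕ) / b = j} = b := by
  have h1 : #{k : Fin n | (k : ℕ) / b = j} = #(Finset.Ico (j * b) ((j + 1) * b)) := by
    rw [← Finset.card_map Fin.valEmbedding]
    congr 1
    have hle : (j + 1) * b ≤ n := by
      calc (j + 1) * b ≤ n / b * b := Nat.mul_le_mul_right _ hj
        _ ≤ n := Nat.div_mul_le_self n b
    ext k
    simp only [Finset.mem_map, Finset.mem_filter, Finset.mem_univ, true_and, Fin.valEmbedding_apply,
      Finset.mem_Ico]
    constructor
    · rintro ⟨k, hk, rfl⟩
      rw [Nat.div_eq_iff hb] at hk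
      rw [add_mul, one_mul]
      omega
    · rintro ⟨h1, h2⟩
      refine ⟨⟨k, by omega⟩, ?_, rfl⟩
      rw [Nat.div_eq_iff hb]
      rw [add_mul, one_mul] at h2
      exact ⟨h1, by show k ≤ _; omega⟩
  rw [h1, Nat.card_Ico, ← Nat.sub_mul]
  simp

theorem sum_eq_sum_blocks (hbn : b ∣ n) (F : Fin n → ℝ) :
    ∑ k, F k = ∑ j ∈ Finset.range (n / b), ∑ k ∈ {k : Fin n | (k : ℕ) / b = j}, F k :=
  (Finset.sum_fiberwise_of_maps_to (fun k _ => Finset.mem_range.2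
    (Nat.div_lt_div_of_lt_of_dvd hbn k.2)) F).symm

theorem sum_block_const (hb : 0 < b) (hbn : b ∣ n) (h : ℕ → ℝ) :
    ∑ k : Fin n, h ((k : ℕ) / b) = b * ∑ j ∈ Finset.range (n / b), h j := by
  rw [sum_eq_sum_blocks hbn, Finset.mul_sum]
  refine Finset.sum_congr rfl fun j hj => ?_
  rw [Finset.sum_congr rfl fun k hk => congrArg h (Finset.mem_filter.1 hk).2, Finset.sum_const,
    card_block hb (Finset.mem_range.1 hj), nsmul_eq_mul]

theorem card_fin_lt_le (x : ℝ) (hx : 0 ≤ x) : (#{k : Fin n | ((k : ℕ) : ℝ) + 1 < x} : ℝ) ≤ x := by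
  have h : #{k : Fin n | ((k : ℕ) : ℝ) + 1 < x} ≤ ⌊x⌋₊ := by
    rw [← Finset.card_map Fin.valEmbedding, ← Finset.card_range ⌊x⌋₊]
    refine Finset.card_le_card fun k hk => ?_
    simp only [Finset.mem_map, Finset.mem_filter, Finset.mem_univ, true_and,
      Fin.valEmbedding_apply] at hk
    obtain ⟨k, hk, rfl⟩ := hk
    rw [Finset.mem_range, Nat.lt_iff_add_one_le]
    exact Nat.le_floor (by push_cast; exact hk.le)
  exact (Nat.cast_le.2 h).trans (Nat.floor_le hx)

theorem card_fin_gt_le (x : ℝ) (hx : 0 ≤ x) : (#{k : Fin n | (n : ℝ) - (k : ℕ) < x} : ℝ) ≤ x := by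
  refine le_trans (le_of_eq ?_) (card_fin_lt_le (n := n) x hx)
  rw [← Finset.card_map Fin.revPerm.toEmbedding]
  congr 2
  ext k
  simp only [Finset.mem_map_equiv, Finset.mem_filter, Finset.mem_univ, true_and]
  have : (((Fin.revPerm.symm k : Fin n) : ℕ) : ℝ) = n - ((k : ℕ) + 1) := by
    rw [Fin.revPerm_symm, Fin.revPerm_apply, Fin.val_rev, Nat.cast_sub (by omega)]
    push_cast; rfl
  rw [this, sub_sub_cancel]

/-- A gain of the functions `g (j + 1)` over `g j` on the blocks is a gain of the functions
`g (j + 1)` on the blocks over the positions up to there, if the functions behave uniformly. -/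
theorem le_sum_sub_prefix_average (hb : 0 < b) (hbn : b ∣ n) (hn : 0 < n) (g : ℕ → Fin n → ℝ)
    (hg : ∀ j k, g j k ∈ Set.Icc (0 : ℝ) 1) {β : ℝ} (hβ : 0 < β) (hb20 : 20 * (b : ℝ) ≤ β * n)
    (hprog : n * β ≤ ∑ k : Fin n, (g ((k : ℕ) / b + 1) k - g ((k : ℕ) / b) k))
    (hfwd : ∑ k : Fin n, ((∑ l with k ≤ l, g ((k : ℕ) / b) l) / (n - (k : ℕ)) -
      g ((k : ℕ) / b) k) ≤ n * β / 8)
    (hsuf : ∀ j < n / b, ∀ k : Fin n, n * β / 8 ≤ n - (k : ℕ) →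
      (n - (k : ℕ)) * ((∑ l, g j l) / n - β / 8) ≤ ∑ l with k ≤ l, g j l)
    (hpre : ∀ j < n / b, ∀ k : Fin n, n * β / 8 ≤ (k : ℕ) + 1 →
      ∑ l with l ≤ k, g j l ≤ ((k : ℕ) + 1) * ((∑ l, g j l) / n + β / 8)) :
    n * β / 4 ≤ ∑ k : Fin n, (g ((k : ℕ) / b + 1) k -
      (∑ l with l ≤ k, g ((k : ℕ) / b + 1) l) / ((k : ℕ) + 1)) := by
  set a : ℕ → ℝ := fun j => (∑ l, g j l) / n with ha
  have ha01 : ∀ j, a j ∈ Set.Icc (0 : ℝ) 1 := fun j => by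
    have := average_mem_Icc Finset.univ (g j) fun k _ => hg j k
    simpa [ha] using this
  have hnβ : 0 ≤ n * β / 8 := by positivity
  have hn0 : (0 : ℝ) < n := by exact_mod_cast hn
  have hkN : ∀ k : Fin n, (k : ℕ) / b < n / b := fun k => Nat.div_lt_div_of_lt_of_dvd hbn k.2
  have hpos : ∀ k : Fin n, (0 : ℝ) < n - (k : ℕ) := fun k => by
    have : ((k : ℕ) : ℝ) < n := by exact_mod_cast k.2
    linarith
  -- Long suffixes lose at most β/8 per position; at most nβ/8 positions have a short suffix, and
  -- each of these loses at most 1.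
  have t3 : -(n * β / 8) - n * β / 8 ≤ ∑ k : Fin n,
      ((∑ l with k ≤ l, g ((k : ℕ) / b) l) / (n - (k : ℕ)) - a ((k : ℕ) / b)) := by
    have h : ∀ k : Fin n, -(β / 8) - (if (n : ℝ) - (k : ℕ) < n * β / 8 then 1 else 0) ≤
        (∑ l with k ≤ l, g ((k : ℕ) / b) l) / (n - (k : ℕ)) - a ((k : ℕ) / b) := by
      intro k
      split_ifs with hk
      · have h1 : 0 ≤ (∑ l with k ≤ l, g ((k : ℕ) / b) l) / (n - (k : ℕ)) :=
          div_nonneg (Finset.sum_nonneg fun l _ => (hg _ l).1) (hpos k).le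
        linarith [(ha01 ((k : ℕ) / b)).2]
      · have h1 := hsuf _ (hkN k) k (not_lt.1 hk)
        have h2 : a ((k : ℕ) / b) - β / 8 ≤
            (∑ l with k ≤ l, g ((k : ℕ) / b) l) / (n - (k : ℕ)) := by
          rw [le_div_iff₀ (hpos k), mul_comm]; exact h1
        linarith
    refine le_trans ?_ (Finset.sum_le_sum fun k _ => h k)
    rw [Finset.sum_sub_distrib, Finset.sum_boole, Finset.sum_const, Finset.card_univ,
      Fintype.card_fin, nsmul_eq_mul]
    have := card_fin_gt_le (n := n) _ hnβ
    linarith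
  -- As for suffixes, with one more loss: nothing is assumed about the averages of `g (n / b)`, the
  -- function after the last block, so the b ≤ nβ/20 positions of that block are given up.
  have t5 : -(n * β / 8) - n * β / 8 - n * β / 20 ≤ ∑ k : Fin n, (a ((k : ℕ) / b + 1) -
      (∑ l with l ≤ k, g ((k : ℕ) / b + 1) l) / ((k : ℕ) + 1)) := by
    have h : ∀ k : Fin n, -(β / 8) - (if ((k : ℕ) : ℝ) + 1 < n * β / 8 then 1 else 0) -
        (if (k : ℕ) / b = n / b - 1 then 1 else 0) ≤ a ((k : ℕ) / b + 1) -
          (∑ l with l ≤ k, g ((k : ℕ) / b + 1) l) / ((k : ℕ) + 1) := by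
      intro k
      have h1 : (∑ l with l ≤ k, g ((k : ℕ) / b + 1) l) / ((k : ℕ) + 1) ≤ 1 := by
        have := (average_mem_Icc (Finset.Iic k) (g ((k : ℕ) / b + 1)) fun l _ => hg _ l).2
        rw [Fin.card_Iic] at this
        have e : Finset.filter (fun l => l ≤ k) Finset.univ = Finset.Iic k := by ext; simp
        rw [e]
        exact_mod_cast this
      have h0 := (ha01 ((k : ℕ) / b + 1)).1
      by_cases hk : ((k : ℕ) : ℝ) + 1 < n * β / 8
      · rw [if_pos hk]; split_ifs <;> linarith
      · by_cases hk2 : (k : ℕ) / b = n / b - 1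
        · rw [if_pos hk2, if_neg hk]; linarith
        · rw [if_neg hk, if_neg hk2]
          have hlt : ∀ q N : ℕ, q < N → ¬ q = N - 1 → q + 1 < N := by omega
          have h2 := hpre ((k : ℕ) / b + 1) (hlt _ _ (hkN k) hk2) k (not_lt.1 hk)
          have h3 : (∑ l with l ≤ k, g ((k : ℕ) / b + 1) l) / ((k : ℕ) + 1) ≤
              a ((k : ℕ) / b + 1) + β / 8 := by
            rw [div_le_iff₀ (by positivity), mul_comm]; exact h2
          linarith
    refine le_trans ?_ (Finset.sum_le_sum fun k _ => h k)
    have hN : 0 < n / b := Nat.div_pos (Nat.le_of_dvd hn hbn) hb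
    rw [Finset.sum_sub_distrib, Finset.sum_sub_distrib, Finset.sum_boole, Finset.sum_boole,
      Finset.sum_const, Finset.card_univ, Fintype.card_fin, nsmul_eq_mul,
      card_block hb (by omega)]
    have := card_fin_lt_le (n := n) _ hnβ
    linarith
  -- The averages over all positions telescope, at a cost of at most b.
  have t4 : -(n * β / 20) ≤ ∑ k : Fin n, (a ((k : ℕ) / b) - a ((k : ℕ) / b + 1)) := by
    rw [sum_block_const hb hbn fun j => a j - a (j + 1), Finset.sum_range_sub']
    have h1 := (ha01 0).1
    have h2 := (ha01 (n / b)).2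
    have h3 : (0 : ℝ) < b := by exact_mod_cast hb
    nlinarith
  -- In units of nβ, the five sums contribute at least 1 - 1/8 - 1/4 - 1/20 - 3/10 = 0.275 > 1/4.
  have e : ∑ k : Fin n, (g ((k : ℕ) / b + 1) k -
      (∑ l with l ≤ k, g ((k : ℕ) / b + 1) l) / ((k : ℕ) + 1)) =
      ∑ k : Fin n, (g ((k : ℕ) / b + 1) k - g ((k : ℕ) / b) k) -
      ∑ k : Fin n, ((∑ l with k ≤ l, g ((k : ℕ) / b) l) / (n - (k : ℕ)) - g ((k : ℕ) / b) k) +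
      ∑ k : Fin n, ((∑ l with k ≤ l, g ((k : ℕ) / b) l) / (n - (k : ℕ)) - a ((k : ℕ) / b)) +
      ∑ k : Fin n, (a ((k : ℕ) / b) - a ((k : ℕ) / b + 1)) +
      ∑ k : Fin n, (a ((k : ℕ) / b + 1) -
        (∑ l with l ≤ k, g ((k : ℕ) / b + 1) l) / ((k : ℕ) + 1)) := by
    rw [← Finset.sum_sub_distrib, ← Finset.sum_add_distrib, ← Finset.sum_add_distrib,
      ← Finset.sum_add_distrib]
    exact Finset.sum_congr rfl fun k _ => by ring
  rw [e]
  have : 0 < n * β := by positivity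
  linarith

end Blocks

section Progress

variable (S : Software) {n d : ℕ} (arch : Bits) (X : Fin n → Bits)

theorem mul_acc_batch {b : ℕ} (hb : 0 < b) (σ : Equiv.Perm (Fin n)) {j : ℕ}
    (hj : j < n / b) (W : Fin d → ℚ) :
    b * acc S arch X W (batch b σ j) = ∑ k ∈ {k : Fin n | (k : ℕ) / b = j}, score S arch X W (σ k) := by
  have h1 : ∀ F : Fin n → ℝ, ∑ x ∈ batch b σ j, F x = ∑ k ∈ {k : Fin n | (k : ℕ) / b = j}, F (σ k) := by
    intro F
    refine (Finset.sum_equiv σ (fun k => ?_) fun k _ => rfl).symm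
    simp [mem_batch]
  have hcard : (#(batch b σ j) : ℝ) = b := by
    have := h1 fun _ => 1
    simpa [card_block hb hj] using this
  have hb' : (b : ℝ) ≠ 0 := by positivity
  rw [acc, hcard, mul_div_cancel₀ _ hb', ← h1, ← Finset.sum_boole]
  rfl

theorem sum_score_sub_eq {b : ℕ} (hb : 0 < b) (hbn : b ∣ n) (σ : Equiv.Perm (Fin n))
    (f : ℕ → Fin d → ℚ) :
    ∑ k : Fin n, (score S arch X (f ((k : ℕ) / b + 1)) (σ k) -
        score S arch X (f ((k : ℕ) / b)) (σ k)) =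
      b * ∑ j ∈ Finset.range (n / b),
        (acc S arch X (f (j + 1)) (batch b σ j) - acc S arch X (f j) (batch b σ j)) := by
  rw [sum_eq_sum_blocks hbn, Finset.mul_sum]
  refine Finset.sum_congr rfl fun j hj => ?_
  have hj' := Finset.mem_range.1 hj
  rw [mul_sub, mul_acc_batch S arch X hb σ hj', mul_acc_batch S arch X hb σ hj',
    ← Finset.sum_sub_distrib]
  refine Finset.sum_congr rfl fun k hk => ?_
  rw [(Finset.mem_filter.1 hk).2]

theorem acc_mem_Icc (W : Fin d → ℚ) (A : Finset (Fin n)) :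
    acc S arch X W A ∈ Set.Icc (0 : ℝ) 1 := by
  unfold acc
  exact ⟨by positivity, div_le_one_of_le₀ (by exact_mod_cast Finset.card_filter_le _ _)
    (by positivity)⟩

end Progress

end SGD

/-! ### Exceptional orders of a single epoch. -/

namespace SGD

open Finset Real

section Exceptional

variable {n d : ℕ}

/-- The indicator of a Boolean function. -/
noncomputable def ind (f : Fin n → Bool) (x : Fin n) : ℝ := if f x then 1 else 0

theorem ind_mem (f : Fin n → Bool) (x : Fin n) : ind f x ∈ Set.Icc (0 : ℝ) 1 := by
  unfold ind; split_ifs <;> simp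

open Classical in
/-- The functions on the dataset of complexity at most `r`. -/
noncomputable def simpleFunctions (U : Bits → ℕ →. ℕ) (X : Fin n → Bits) (r : ℝ) :
    Finset (Fin n → Bool) :=
  {f | (condK U (List.ofFn f) (List.ofFn X) : ℝ) ≤ r}

theorem card_simpleFunctions_le {U : Bits → ℕ →. ℕ} (hU : IsUniversalPrefixMachine U)
    (X : Fin n → Bits) {r : ℝ} (hr : 0 ≤ r) : (#(simpleFunctions U X r) : ℝ) ≤ 2 * exp r := by
  classical
  have h1 : #(simpleFunctions U X r) ≤ 2 ^ (⌊r⌋₊ + 1) := by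
    rw [← Finset.card_map ⟨List.ofFn, List.ofFn_injective⟩]
    refine card_le_of_condK_le hU (List.ofFn X) ⌊r⌋₊ _ fun l hl => ?_
    obtain ⟨f, hf, rfl⟩ := Finset.mem_map.1 hl
    exact Nat.le_floor (Finset.mem_filter.1 hf).2
  -- Base e is wasteful, but matches the exponentials of the deviation bounds.
  have h2 : (2 : ℝ) ^ ⌊r⌋₊ ≤ exp r := by
    calc (2 : ℝ) ^ ⌊r⌋₊ ≤ exp 1 ^ ⌊r⌋₊ := by
          gcongr
          linarith [exp_one_gt_d9]
      _ = exp ⌊r⌋₊ := by rw [← exp_nat_mul, mul_one]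
      _ ≤ exp r := exp_le_exp.2 (Nat.floor_le hr)
  calc (#(simpleFunctions U X r) : ℝ) ≤ ((2 ^ (⌊r⌋₊ + 1) : ℕ) : ℝ) := Nat.cast_le.2 h1
    _ = 2 * 2 ^ ⌊r⌋₊ := by push_cast; ring
    _ ≤ _ := by gcongr

open Classical in
/-- The orders in which some function of the family deviates on a long suffix from its average. -/
noncomputable def suffixDeviation (F : Finset (Fin n → Bool)) (β : ℝ) :
    Finset (Equiv.Perm (Fin n)) :=
  {σ | ∃ f ∈ F, ∃ k : Fin n, n * β / 8 ≤ n - (k : ℕ) ∧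
    ∑ l with k ≤ l, ind f (σ l) ≤ (n - (k : ℕ)) * ((∑ x, ind f x) / n - β / 8)}

open Classical in
/-- The orders in which some function of the family deviates on a long prefix from its average. -/
noncomputable def prefixDeviation (F : Finset (Fin n → Bool)) (β : ℝ) :
    Finset (Equiv.Perm (Fin n)) :=
  {σ | ∃ f ∈ F, ∃ k : Fin n, n * β / 8 ≤ (k : ℕ) + 1 ∧
    ((k : ℕ) + 1) * ((∑ x, ind f x) / n + β / 8) ≤ ∑ l with l ≤ k, ind f (σ l)}

/-- Hoeffding's exponent for deviation β/8 and sample size at least nβ/8 is 2(β/8)²(nβ/8) = nβ³/256;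
the factor n counts the possible suffixes. -/
theorem card_suffixDeviation_le (F : Finset (Fin n → Bool)) {β : ℝ} (hβ : 0 < β) :
    (#(suffixDeviation F β) : ℝ) ≤ #F * (n * (n.factorial * exp (-(n * β ^ 3 / 256)))) := by
  classical
  set A : (Fin n → Bool) → Fin n → Finset (Equiv.Perm (Fin n)) := fun f k =>
    {σ | n * β / 8 ≤ n - (k : ℕ) ∧
      ∑ l with k ≤ l, ind f (σ l) ≤ (n - (k : ℕ)) * ((∑ x, ind f x) / n - β / 8)} with hA
  have hsub : suffixDeviation F β ⊆ F.biUnion fun f => Finset.univ.biUnion (A f) := by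
    intro σ hσ
    obtain ⟨f, hf, k, hk⟩ := (Finset.mem_filter.1 hσ).2
    simp only [Finset.mem_biUnion, Finset.mem_univ, true_and]
    exact ⟨f, hf, k, Finset.mem_filter.2 ⟨Finset.mem_univ _, hk⟩⟩
  have hcard : ∀ f k, (#(A f k) : ℝ) ≤ n.factorial * exp (-(n * β ^ 3 / 256)) := by
    intro f k
    rcases (A f k).eq_empty_or_nonempty with h | ⟨σ, hσ⟩
    · rw [h]; simp; positivity
    · have hk := (Finset.mem_filter.1 hσ).2.1
      refine (card_suffix_deviation_le k.2 (ind f) (ind_mem f) (δ := β / 8) (by positivity) (A f k)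
        fun τ hτ => ?_).trans ?_
      · have := (Finset.mem_filter.1 hτ).2.2
        simpa only [Fin.le_def] using this
      · gcongr
        have : (β / 8) ^ 2 * (n * β / 8) ≤ (β / 8) ^ 2 * (n - (k : ℕ)) := by gcongr
        nlinarith
  calc (#(suffixDeviation F β) : ℝ) ≤ #(F.biUnion fun f => Finset.univ.biUnion (A f)) :=
        Nat.cast_le.2 (Finset.card_le_card hsub)
    _ ≤ ∑ f ∈ F, ∑ k, (#(A f k) : ℝ) := by
        refine (Nat.cast_le.2 Finset.card_biUnion_le).trans ?_
        push_cast
        refine Finset.sum_le_sum fun f _ => ?_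
        exact_mod_cast Finset.card_biUnion_le
    _ ≤ ∑ f ∈ F, ∑ k : Fin n, n.factorial * exp (-(n * β ^ 3 / 256)) :=
        Finset.sum_le_sum fun f _ => Finset.sum_le_sum fun k _ => hcard f k
    _ = _ := by simp

theorem card_prefixDeviation_le (F : Finset (Fin n → Bool)) {β : ℝ} (hβ : 0 < β) :
    (#(prefixDeviation F β) : ℝ) ≤ #F * (n * (n.factorial * exp (-(n * β ^ 3 / 256)))) := by
  classical
  set A : (Fin n → Bool) → Fin n → Finset (Equiv.Perm (Fin n)) := fun f k =>
    {σ | n * β / 8 ≤ (k : ℕ) + 1 ∧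
      ((k : ℕ) + 1) * ((∑ x, ind f x) / n + β / 8) ≤ ∑ l with l ≤ k, ind f (σ l)} with hA
  have hsub : prefixDeviation F β ⊆ F.biUnion fun f => Finset.univ.biUnion (A f) := by
    intro σ hσ
    obtain ⟨f, hf, k, hk⟩ := (Finset.mem_filter.1 hσ).2
    simp only [Finset.mem_biUnion, Finset.mem_univ, true_and]
    exact ⟨f, hf, k, Finset.mem_filter.2 ⟨Finset.mem_univ _, hk⟩⟩
  have hcard : ∀ f k, (#(A f k) : ℝ) ≤ n.factorial * exp (-(n * β ^ 3 / 256)) := by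
    intro f k
    rcases (A f k).eq_empty_or_nonempty with h | ⟨σ, hσ⟩
    · rw [h]; simp; positivity
    · have hk := (Finset.mem_filter.1 hσ).2.1
      refine (card_prefix_deviation_le (m := (k : ℕ) + 1) (by omega) k.2 (ind f) (ind_mem f)
        (δ := β / 8) (by positivity) (A f k) fun τ hτ => ?_).trans ?_
      · have := (Finset.mem_filter.1 hτ).2.2
        simp only [Fin.le_def] at this
        simp only [Nat.lt_succ_iff]
        exact_mod_cast this
      · gcongr
        push_cast
        have : (β / 8) ^ 2 * (n * β / 8) ≤ (β / 8) ^ 2 * ((k : ℕ) + 1) := by gcongr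
        nlinarith
  calc (#(prefixDeviation F β) : ℝ) ≤ #(F.biUnion fun f => Finset.univ.biUnion (A f)) :=
        Nat.cast_le.2 (Finset.card_le_card hsub)
    _ ≤ ∑ f ∈ F, ∑ k, (#(A f k) : ℝ) := by
        refine (Nat.cast_le.2 Finset.card_biUnion_le).trans ?_
        push_cast
        refine Finset.sum_le_sum fun f _ => ?_
        exact_mod_cast Finset.card_biUnion_le
    _ ≤ ∑ f ∈ F, ∑ k : Fin n, n.factorial * exp (-(n * β ^ 3 / 256)) :=
        Finset.sum_le_sum fun f _ => Finset.sum_le_sum fun k _ => hcard f k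
    _ = _ := by simp

variable (S : Software) (arch : Bits) (X : Fin n → Bits)

open Classical in
/-- The orders in which the models of an epoch lose much accuracy on the next batches. -/
noncomputable def forwardLoss (b : ℕ) (β : ℝ) (V : Fin d → ℚ) : Finset (Equiv.Perm (Fin n)) :=
  {σ | n * β / 8 ≤ ∑ k : Fin n, ((∑ l with k ≤ l,
      score S arch X (afterBatches S arch X b σ V ((k : ℕ) / b)) (σ l)) / (n - (k : ℕ)) -
        score S arch X (afterBatches S arch X b σ V ((k : ℕ) / b)) (σ k))}

theorem card_forwardLoss_le (hn : 0 < n) (b : ℕ) {β : ℝ} (hβ : 0 < β) (V : Fin d → ℚ) :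
    (#(forwardLoss S arch X b β V) : ℝ) ≤ n.factorial * exp (-(n * β ^ 2 / 32)) := by
  refine (card_forward_loss_le hn V (x := n * β / 8) (by positivity) _
    fun σ hσ => (Finset.mem_filter.1 hσ).2).trans_eq ?_
  congr 3
  field_simp
  norm_num

/-- The orders of an epoch, starting with the model `V`, that have to be excluded. -/
noncomputable def exceptional (U : Bits → ℕ →. ℕ) (b : ℕ) (β : ℝ) (V : Fin d → ℚ) :
    Finset (Equiv.Perm (Fin n)) :=
  forwardLoss S arch X b β V ∪ (suffixDeviation (simpleFunctions U X (n * β ^ 3 / 512)) β ∪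
    prefixDeviation (simpleFunctions U X (n * β ^ 3 / 512)) β)

/-- The union over at most 2 exp(nβ³/512) simple functions uses up half of the exponent nβ³/256;
this fixes the constant 512. The factor 5n is n for the forward loss, and 2n each for suffixes and
prefixes. -/
theorem card_exceptional_le {U : Bits → ℕ →. ℕ} (hU : IsUniversalPrefixMachine U) (hn : 0 < n)
    (b : ℕ) {β : ℝ} (hβ : 0 < β) (hβ1 : β ≤ 1) (V : Fin d → ℚ) :
    (#(exceptional S arch X U b β V) : ℝ) ≤ n.factorial * (5 * n * exp (-(n * β ^ 3 / 512))) := by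
  set F := simpleFunctions U X (n * β ^ 3 / 512) with hF
  have hn1 : (1 : ℝ) ≤ n := by exact_mod_cast hn
  have hF' : (#F : ℝ) ≤ 2 * exp (n * β ^ 3 / 512) := card_simpleFunctions_le hU X (by positivity)
  have h1 := card_forwardLoss_le S arch X hn b hβ V
  have h2 := card_suffixDeviation_le F hβ
  have h3 := card_prefixDeviation_le F hβ
  have h4 : (#(exceptional S arch X U b β V) : ℝ) ≤ #(forwardLoss S arch X b β V) +
      (#(suffixDeviation F β) + #(prefixDeviation F β)) := by
    have e1 := Finset.card_union_le (forwardLoss S arch X b β V)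
      (suffixDeviation F β ∪ prefixDeviation F β)
    have e2 := Finset.card_union_le (suffixDeviation F β) (prefixDeviation F β)
    exact_mod_cast e1.trans (by omega)
  have h5 : exp (-(n * β ^ 2 / 32)) ≤ n * exp (-(n * β ^ 3 / 512)) := by
    have : exp (-(n * β ^ 2 / 32)) ≤ exp (-(n * β ^ 3 / 512)) := by
      refine exp_le_exp.2 (neg_le_neg ?_)
      have h : β ^ 3 ≤ β ^ 2 := by nlinarith [sq_nonneg β]
      have : (n : ℝ) * β ^ 3 ≤ n * β ^ 2 := by gcongr
      have : (0 : ℝ) ≤ n * β ^ 2 := by positivity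
      linarith
    nlinarith [exp_pos (-(n * β ^ 3 / 512))]
  have h6 : #F * (n * (n.factorial * exp (-(n * β ^ 3 / 256)))) ≤
      n.factorial * (2 * n * exp (-(n * β ^ 3 / 512))) := by
    calc #F * (n * (n.factorial * exp (-(n * β ^ 3 / 256)))) ≤ 2 * exp (n * β ^ 3 / 512) *
          (n * (n.factorial * exp (-(n * β ^ 3 / 256)))) := by gcongr
      _ = n.factorial * (2 * n * (exp (n * β ^ 3 / 512) * exp (-(n * β ^ 3 / 256)))) := by ring
      _ = _ := by rw [← exp_add]; congr 3; ring
  have h7 : n.factorial * exp (-(n * β ^ 2 / 32)) ≤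
      n.factorial * (n * exp (-(n * β ^ 3 / 512))) := by gcongr
  linarith

variable {S arch X}

/-- In an unexceptional epoch with simple functions, local progress makes the models better on
their batches than on the previous elements. -/
theorem le_advantage {U : Bits → ℕ →. ℕ} {b : ℕ} (hb : 0 < b) (hbn : b ∣ n) (hn : 0 < n) {β : ℝ}
    (hβ : 0 < β) (hb20 : 20 * (b : ℝ) ≤ β * n) {V : Fin d → ℚ} {σ : Equiv.Perm (Fin n)}
    (hσ : σ ∉ exceptional S arch X U b β V)
    (hprog : β < (b : ℝ) / n * ∑ j ∈ Finset.range (n / b),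
      (acc S arch X (afterBatches S arch X b σ V (j + 1)) (batch b σ j) -
        acc S arch X (afterBatches S arch X b σ V j) (batch b σ j)))
    (hsimple : ∀ j < n / b,
      (condK U (List.ofFn (accFun S arch X (afterBatches S arch X b σ V j))) (List.ofFn X) : ℝ) ≤
        n * β ^ 3 / 512) :
    n * β / 4 ≤ advantage S arch X b σ (afterBatches S arch X b σ V) := by
  have hn0 : (0 : ℝ) < n := by exact_mod_cast hn
  simp only [exceptional, Finset.mem_union, not_or] at hσ
  obtain ⟨h1, h2, h3⟩ := hσ
  have hmem : ∀ j < n / b, accFun S arch X (afterBatches S arch X b σ V j) ∈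
      simpleFunctions U X (n * β ^ 3 / 512) :=
    fun j hj => Finset.mem_filter.2 ⟨Finset.mem_univ _, hsimple j hj⟩
  have hsum : ∀ j, ∑ l, score S arch X (afterBatches S arch X b σ V j) (σ l) =
      ∑ x, ind (accFun S arch X (afterBatches S arch X b σ V j)) x :=
    fun j => Equiv.sum_comp σ (score S arch X (afterBatches S arch X b σ V j))
  refine le_sum_sub_prefix_average hb hbn hn
    (fun j k => score S arch X (afterBatches S arch X b σ V j) (σ k))
    (fun j k => score_mem _ _ _ _ _) hβ hb20 ?_ ?_ ?_ ?_
  · rw [sum_score_sub_eq S arch X hb hbn σ (afterBatches S arch X b σ V)]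
    rw [div_mul_eq_mul_div, lt_div_iff₀ hn0] at hprog
    linarith
  · by_contra h
    exact h1 (Finset.mem_filter.2 ⟨Finset.mem_univ _, (not_le.1 h).le⟩)
  · intro j hj k hk
    by_contra h
    refine h2 (Finset.mem_filter.2 ⟨Finset.mem_univ _, _, hmem j hj, k, hk, ?_⟩)
    rw [hsum] at h
    exact (not_le.1 h).le
  · intro j hj k hk
    by_contra h
    refine h3 (Finset.mem_filter.2 ⟨Finset.mem_univ _, _, hmem j hj, k, hk, ?_⟩)
    rw [hsum] at h
    exact (not_le.1 h).le

end Exceptional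

end SGD

/-! ### Union bound over the epochs. -/

namespace SGD

open Finset Real

section Product

variable {ι α : Type} [Fintype ι] [DecidableEq ι] [Fintype α] [DecidableEq α]

/-- An event about one coordinate that has small probability given the other coordinates has small
probability. -/
theorem card_coordinate_mem_le (i : ι) (B : (ι → α) → Finset α)
    (hB : ∀ ω a, B (Function.update ω i a) = B ω) {c : ℝ} (hc : ∀ ω, (#(B ω) : ℝ) ≤ c) :
    (#{ω : ι → α | ω i ∈ B ω} : ℝ) * Fintype.card α ≤ c * Fintype.card (ι → α) := by
  have h1 : #((Finset.univ.filter fun ω : ι → α => ω i ∈ B ω) ×ˢ (Finset.univ : Finset α)) =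
      -- Exchanging coordinate `i` of ω with the extra element `a` is a bijection, because `B`
      -- ignores coordinate `i`.
      #(Finset.univ.sigma B) := by
    refine Finset.card_bij' (fun q _ => ⟨Function.update q.1 i q.2, q.1 i⟩)
      (fun q _ => (Function.update q.1 i q.2, q.1 i)) ?_ ?_ ?_ ?_
    · rintro ⟨ω, a⟩ h
      simpa [hB] using h
    · rintro ⟨ω, a⟩ h
      simpa [hB] using h
    · rintro ⟨ω, a⟩ _
      simp
    · rintro ⟨ω, a⟩ _
      simp
  rw [Finset.card_product, Finset.card_sigma, Finset.card_univ] at h1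
  have h2 : (#{ω : ι → α | ω i ∈ B ω} : ℝ) * Fintype.card α = ∑ ω, (#(B ω) : ℝ) := by
    exact_mod_cast h1
  rw [h2]
  calc ∑ ω, (#(B ω) : ℝ) ≤ ∑ _ω : ι → α, c := Finset.sum_le_sum fun ω _ => hc ω
    _ = _ := by simp [mul_comm]

theorem one_sub_le_uniformProb {Ω : Type} [Fintype Ω] [Nonempty Ω] (E : Set Ω) (A : Finset Ω)
    (hA : ∀ ω, ω ∉ A → ω ∈ E) {x : ℝ} (hx : (#A : ℝ) ≤ x * Fintype.card Ω) :
    1 - x ≤ uniformProb E := by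
  classical
  have hpos : (0 : ℝ) < Fintype.card Ω := by exact_mod_cast Fintype.card_pos
  have h1 : Fintype.card Ω ≤ E.ncard + #A := by
    have h2 : (Finset.univ : Finset Ω) ⊆ E.toFinset ∪ A := by
      intro ω _
      by_cases h : ω ∈ A
      · exact Finset.mem_union_right _ h
      · exact Finset.mem_union_left _ (Set.mem_toFinset.2 (hA ω h))
    have := (Finset.card_le_card h2).trans (Finset.card_union_le _ _)
    rwa [Finset.card_univ, ← Set.ncard_eq_toFinset_card'] at this
  have h2 : (Fintype.card Ω : ℝ) ≤ E.ncard + #A := by exact_mod_cast h1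
  rw [uniformProb, le_div_iff₀ hpos]
  linarith

end Product

section Epochs

variable (S : Software) {n d t : ℕ} (arch : Bits) (X : Fin n → Bits)

/-- The initial model of an epoch depends on earlier permutations only. So the exceptional set of
epoch `i` ignores coordinate `i`, as `card_coordinate_mem_le` requires. -/
theorem epochStart_update (b : ℕ) (W₀ : Fin d → ℚ) (ω : Fin t → Equiv.Perm (Fin n)) (i : Fin t)
    (σ : Equiv.Perm (Fin n)) {j : ℕ} (hj : j ≤ i) :
    epochStart S arch X b W₀ (Function.update ω i σ) j = epochStart S arch X b W₀ ω j := by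
  induction j with
  | zero => rfl
  | succ j ih =>
    rw [epochStart, epochStart, ih (by omega)]
    split_ifs with h
    · rw [Function.update_of_ne]
      intro he
      have := congrArg Fin.val he
      simp at this
      omega
    · rfl

theorem epochStart_succ (b : ℕ) (W₀ : Fin d → ℚ) (ω : Fin t → Equiv.Perm (Fin n)) (i : Fin t) :
    epochStart S arch X b W₀ ω (i + 1) =
      afterBatches S arch X b (ω i) (epochStart S arch X b W₀ ω i) (n / b) := by
  rw [epochStart, dif_pos i.2]

variable {S arch X}

/-- Accuracies lie in [0,1], so progress above β is impossible when β > 1, and β ≤ 1 may be assumed.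
-/
theorem local_progress_le_one {b : ℕ} (hb : 0 < b) (hn : 0 < n) (hbn : b ∣ n)
    (σ : Equiv.Perm (Fin n)) (f : ℕ → Fin d → ℚ) :
    (b : ℝ) / n * ∑ j ∈ Finset.range (n / b),
      (acc S arch X (f (j + 1)) (batch b σ j) - acc S arch X (f j) (batch b σ j)) ≤ 1 := by
  have hn0 : (0 : ℝ) < n := by exact_mod_cast hn
  have hb0 : (b : ℝ) ≠ 0 := by positivity
  have h : ∑ j ∈ Finset.range (n / b),
      (acc S arch X (f (j + 1)) (batch b σ j) - acc S arch X (f j) (batch b σ j)) ≤ (n : ℝ) / b := by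
    refine (Finset.sum_le_sum (g := fun _ => (1 : ℝ)) fun j _ => ?_).trans_eq ?_
    · linarith [(acc_mem_Icc S arch X (f (j + 1)) (batch b σ j)).2,
        (acc_mem_Icc S arch X (f j) (batch b σ j)).1]
    · simp [Nat.cast_div hbn hb0]
  calc _ ≤ (b : ℝ) / n * (n / b) := by gcongr
    _ = 1 := by field_simp

/-- The failure probability of all epochs together. -/
theorem union_bound {b : ℕ} {β : ℝ} (ht : 0 < t) (hb : 0 < b) (hβ : 0 < β) (hβ1 : β ≤ 1)
    (hb20 : 20 * (b : ℝ) ≤ β * n)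
    (hlog : 8 * (β ^ 2)⁻¹ * log (t * (n : ℝ) ^ 3) ^ 2 ≤ b) :
    t * (5 * n * exp (-(n * β ^ 3 / 512))) ≤ 1 / (n : ℝ) ^ 2 := by
  have hb1 : (1 : ℝ) ≤ b := by exact_mod_cast hb
  have ht1 : (1 : ℝ) ≤ t := by exact_mod_cast ht
  have hn20 : (20 : ℝ) ≤ n := by nlinarith
  have hn0 : (0 : ℝ) < n := by linarith
  set Λ := log (t * (n : ℝ) ^ 3) with hΛ
  -- Since n ≥ 20 > 16 and t ≥ 1, Λ ≥ 3 log 16 = 12 log 2 > 8.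
  have hΛ8 : 8 ≤ Λ := by
    have h1 : log 16 ≤ log n := log_le_log (by norm_num) (by linarith)
    have h2 : log 16 = 4 * log 2 := by
      rw [show (16 : ℝ) = 2 ^ 4 by norm_num, log_pow]; norm_num
    have h3 : Λ = log t + 3 * log n := by
      rw [hΛ, log_mul (by positivity) (by positivity), log_pow]; norm_num
    have h4 : 0 ≤ log (t : ℝ) := log_nonneg ht1
    linarith [log_two_gt_d9]
  have h1 : 160 * Λ ^ 2 ≤ n * β ^ 3 := by
    have hβ2 : 0 < β ^ 2 := by positivity
    have h2 : 8 * Λ ^ 2 ≤ b * β ^ 2 := by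
      have := mul_le_mul_of_nonneg_right hlog hβ2.le
      rwa [show 8 * (β ^ 2)⁻¹ * Λ ^ 2 * β ^ 2 = 8 * Λ ^ 2 by field_simp] at this
    have h3 : 20 * b * β ^ 2 ≤ β * n * β ^ 2 := by gcongr
    nlinarith
  have h5 : log 5 ≤ 3 := by
    have : log 5 ≤ log 8 := log_le_log (by norm_num) (by norm_num)
    have h2 : log 8 = 3 * log 2 := by
      rw [show (8 : ℝ) = 2 ^ 3 by norm_num, log_pow]; norm_num
    linarith [log_two_lt_d9]
  -- 160Λ²/512 ≥ 2.5Λ because Λ ≥ 8, and 1.5Λ exceeds log 5.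
  have h6 : log 5 + Λ ≤ n * β ^ 3 / 512 := by nlinarith
  have h7 : 5 * (t * (n : ℝ) ^ 3) ≤ exp (n * β ^ 3 / 512) := by
    rw [← log_le_iff_le_exp (by positivity), log_mul (by norm_num) (by positivity)]
    exact h6
  rw [le_div_iff₀ (by positivity)]
  calc t * (5 * n * exp (-(n * β ^ 3 / 512))) * (n : ℝ) ^ 2 =
        5 * (t * (n : ℝ) ^ 3) * exp (-(n * β ^ 3 / 512)) := by ring
    _ ≤ exp (n * β ^ 3 / 512) * exp (-(n * β ^ 3 / 512)) := by gcongr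
    _ = 1 := by rw [← exp_add]; simp

end Epochs

end SGD

theorem mainTheorem2 (U : SGD.Bits → ℕ →. ℕ) (hU : SGD.IsUniversalPrefixMachine U)
    (S : SGD.Software) :
    ∃ C : ℝ, ∀ (n b t d : ℕ) (arch : SGD.Bits) (X : Fin n → SGD.Bits) (W₀ : Fin d → ℚ)
      (ε β' L : ℝ),
      0 < ε → ε < 1 → 0 < β' → 0 < b → b ∣ n →
      20 * (b : ℝ) ≤ β' * ε * (n : ℝ) →
      8 * ((β' * ε) ^ 2)⁻¹ * (Real.log ((t : ℝ) * (n : ℝ) ^ 3)) ^ 2 ≤ (b : ℝ) →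
      0 < S.rate arch → (S.rate arch : ℝ) * L < 1 → SGD.IsSmooth S arch X d L →
      1 - 1 / (n : ℝ) ^ 2 ≤
        SGD.uniformProb {ω : Fin t → Equiv.Perm (Fin n) |
          SGD.GoodRun S arch X U b ε β' W₀ ω →
            ∀ i : Fin t, (SGD.permComplexity S arch X U b W₀ ω i : ℝ) ≤
              (n : ℝ) * (Real.logb 2 ((n : ℝ) / Real.exp 1) - (β' * ε) ^ 3 / 512) +
                C * Real.logb 2 (n : ℝ)} := by
  classical
  obtain ⟨C, hC⟩ := SGD.condK_permList_le hU S
  refine ⟨C, fun n b t d arch X W₀ ε β' L hε _ hβ' hb hbn hb20 hlog hα hL hS => ?_⟩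
  set β := β' * ε with hβdef
  have hβ : 0 < β := mul_pos hβ' hε
  have hn : 0 < n := by
    rcases Nat.eq_zero_or_pos n with rfl | h
    · have : (0 : ℝ) < b := by exact_mod_cast hb
      rw [Nat.cast_zero, mul_zero] at hb20
      linarith
    · exact h
  -- without epochs, or with an impossible amount of progress, there is nothing to show
  by_cases htriv : 0 < t ∧ β ≤ 1
  swap
  · refine SGD.one_sub_le_uniformProb _ ∅ (fun ω _ hω i => ?_) (by simp; positivity)
    refine absurd ⟨i.pos, ?_⟩ htriv
    exact (hω.local_progress i).le.trans (SGD.local_progress_le_one hb hn hbn (ω i)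
      (SGD.model S arch X b W₀ ω i))
  obtain ⟨ht, hβ1⟩ := htriv
  have hb1 : (1 : ℝ) ≤ b := by exact_mod_cast hb
  have hn20 : (20 : ℝ) ≤ n := by
    have : (0 : ℝ) < n := by exact_mod_cast hn
    nlinarith
  have hn2 : 2 ≤ n := by
    have : (2 : ℝ) ≤ n := by linarith
    exact_mod_cast this
  set B : Fin t → (Fin t → Equiv.Perm (Fin n)) → Finset (Equiv.Perm (Fin n)) := fun i ω =>
    SGD.exceptional S arch X U b β (SGD.epochStart S arch X b W₀ ω i) with hB
  refine SGD.one_sub_le_uniformProb _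
    (Finset.univ.biUnion fun i => Finset.univ.filter fun ω => ω i ∈ B i ω) (fun ω hω => ?_) ?_
  · intro hgood i
    have hσ : ω i ∉ B i ω := by simpa using fun h => hω (by simpa using ⟨i, h⟩)
    have hadv := SGD.le_advantage hb hbn hn hβ hb20 hσ (hgood.local_progress i) (hgood.simple i)
    have hnβ : 0 ≤ n * β / 4 := by positivity
    have hfloor := Nat.floor_le hnβ
    have hlt := Nat.lt_floor_add_one (n * β / 4)
    rw [SGD.permComplexity, SGD.epochStart_succ]
    -- The threshold handed to the decoder must be an integer. Rounding down keeps it above nβ/8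
    -- because nβ ≥ 20b ≥ 20.
    refine hC n b d ⌊n * β / 4⌋₊ ((i : ℕ) + 1) arch X (SGD.epochStart S arch X b W₀ ω i) (ω i) L β
      hα hL hS hb hbn hn2 hβ hβ1 ?_ ?_ (hgood.representable i) (hfloor.trans hadv)
    · refine Nat.floor_le_of_le ?_
      nlinarith
    · linarith
  · set c : ℝ := n.factorial * (5 * n * Real.exp (-(n * β ^ 3 / 512))) with hc
    have hfac : (0 : ℝ) < n.factorial := by exact_mod_cast n.factorial_pos
    have hcard : Fintype.card (Equiv.Perm (Fin n)) = n.factorial := by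
      simpa using Fintype.card_perm (α := Fin n)
    have h1 : ∀ i : Fin t, ((Finset.univ.filter fun ω => ω i ∈ B i ω).card : ℝ) ≤
        5 * n * Real.exp (-(n * β ^ 3 / 512)) *
          Fintype.card (Fin t → Equiv.Perm (Fin n)) := by
      intro i
      have h := SGD.card_coordinate_mem_le i (B i)
        (fun ω σ => by simp only [hB]; rw [SGD.epochStart_update S arch X b W₀ ω i σ le_rfl])
        (c := c) (fun ω => SGD.card_exceptional_le S arch X hU hn b hβ hβ1 _)
      rw [hcard] at h
      refine le_of_mul_le_mul_right (h.trans_eq ?_) hfac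
      rw [hc]; ring
    have h2 := SGD.union_bound ht hb hβ hβ1 hb20 hlog
    calc _ ≤ ∑ i : Fin t, ((Finset.univ.filter fun ω => ω i ∈ B i ω).card : ℝ) := by
          exact_mod_cast Finset.card_biUnion_le
      _ ≤ ∑ i : Fin t, 5 * n * Real.exp (-(n * β ^ 3 / 512)) *
          (Fintype.card (Fin t → Equiv.Perm (Fin n)) : ℝ) := Finset.sum_le_sum fun i _ => h1 i
      _ = t * (5 * n * Real.exp (-(n * β ^ 3 / 512))) *
          (Fintype.card (Fin t → Equiv.Perm (Fin n)) : ℝ) := by simp; ring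
      _ ≤ _ := by gcongr
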